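/- Consider the Kolmogorov equation $u_t+xu_y=u_{xx}$ for a function $u$ of $(t,x,y)\in\mathbb R^3$. Let $\mathcal A$ be the real algebra of differential functions on the manifold defined by the equation and its differential consequences in the infinite-order jet space, i.e. of smooth functions of $t,x,y$ and finitely many of the jet variables $u_{kl}$, $k,l\in\mathbb N_0$ ($u_{kl}$ stands for $\partial_x^k\partial_y^lu$). Let \[ \mathrm D_t=\partial_t+\sum_{k,l\ge0}(u_{k+2,l}-xu_{k,l+1}-ku_{k-1,l+1})\partial_{u_{kl}},\quad \mathrm D_x=\partial_x+\sum_{k,l\ge0}u_{k+1,l}\partial_{u_{kl}},\quad \mathrm D_y=\partial_y+\sum_{k,l\ge0}u_{k,l+1}\partial_{u_{kl}} \] be the total derivatives restricted to this manifold, and let $\mathrm F=\mathrm D_t+x\mathrm D_y-\mathrm D_x^2$. The (characteristics of) generalized symmetries of the equation are the elements of $\Sigma=\{\eta\in\mathcal A\mid\mathrm F\eta=0\}$. A linear operator $\mathrm Q\colon\mathcal A\to\mathcal A$ is a recursion operator if $\mathrm Q\eta\in\Sigma$ for every $\eta\in\Sigma$. A linear differential recursion operator is a recursion operator that is a linear differential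 operator in total derivatives whose coefficients are smooth functions of $(t,x,y)$ only. Let $\Upsilon$ be the associative algebra of all linear differential recursion operators in $\mathrm D_x$ and $\mathrm D_y$, and let $\Upsilon_{\mathfrak r}$ be the unital associative real algebra of operators on $\mathcal A$ generated by \[ \mathrm P^3=3t^2\mathrm D_x+t^3\mathrm D_y-3(y-tx),\quad \mathrm P^2=2t\mathrm D_x+t^2\mathrm D_y+x,\quad \mathrm P^1=\mathrm D_x+t\mathrm D_y,\quad \mathrm P^0=\mathrm D_y. \] Then $\Upsilon=\Upsilon_{\mathfrak r}$. Moreover, the same holds for operators that also involve $\mathrm D_t$, up to equivalence on symmetries of the equation: for every linear differential recursion operator $\mathrm Q$ in $\mathrm D_t,\mathrm D_x,\mathrm D_y$ there is exactly one $\mathrm R\in\Upsilon_{\mathfrak r}$ with $\mathrm Q\eta=\mathrm R\eta$ for all $\eta\in\Sigma$. -/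

import Mathlib

open scoped ContDiff

namespace Kolmogorov

/-- Coordinates on the manifold defined by the equation `u_t + x u_y = u_xx` and its differential
consequences in the infinite-order jet space: the independent variables `t`, `x`, `y` and the jet
variables `u k l`, standing for the derivative of `u` taken `k` times in `x` and `l` times in `y`. -/
inductive Coord where
  | t : Coord
  | x : Coord
  | y : Coord
  | u : ℕ → ℕ → Coord
  deriving DecidableEq

/-- Points of that manifold. -/
abbrev Jet : Type := Coord → ℝ

/-- `f` is a smooth function of finitely many of the coordinates. -/
def IsDiffFun (f : Jet → ℝ) : Prop :=
  ∃ (S : Finset Coord) (g : ({c // c ∈ S} → ℝ) → ℝ),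
    ContDiff ℝ ∞ g ∧ ∀ z : Jet, f z = g (fun c => z c.1)

theorem IsDiffFun.enlarge {f : Jet → ℝ} {S T : Finset Coord} (hST : S ⊆ T)
    {g : ({c // c ∈ S} → ℝ) → ℝ} (hg : ContDiff ℝ ∞ g)
    (hf : ∀ z : Jet, f z = g (fun c => z c.1)) :
    ∃ h : ({c // c ∈ T} → ℝ) → ℝ, ContDiff ℝ ∞ h ∧ ∀ z : Jet, f z = h (fun c => z c.1) :=
  ⟨fun w => g (fun c => w ⟨c.1, hST c.2⟩), hg.comp (by fun_prop), hf⟩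

theorem IsDiffFun.const (r : ℝ) : IsDiffFun (fun _ => r) :=
  ⟨∅, fun _ => r, contDiff_const, fun _ => rfl⟩

theorem IsDiffFun.coord (c : Coord) : IsDiffFun (fun z => z c) :=
  ⟨{c}, fun w => w ⟨c, Finset.mem_singleton_self c⟩, by fun_prop, fun _ => rfl⟩

theorem IsDiffFun.add {f g : Jet → ℝ} (hf : IsDiffFun f) (hg : IsDiffFun g) :
    IsDiffFun (fun z => f z + g z) := by
  obtain ⟨S, f', hf', hf⟩ := hf
  obtain ⟨T, g', hg', hg⟩ := hg
  obtain ⟨f₁, hf₁, hf⟩ := IsDiffFun.enlarge (Finset.subset_union_left (s₂ := T)) hf' hf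
  obtain ⟨g₁, hg₁, hg⟩ := IsDiffFun.enlarge (Finset.subset_union_right (s₁ := S)) hg' hg
  exact ⟨S ∪ T, fun w => f₁ w + g₁ w, hf₁.add hg₁, fun z => by simp only [hf, hg]⟩

theorem IsDiffFun.mul {f g : Jet → ℝ} (hf : IsDiffFun f) (hg : IsDiffFun g) :
    IsDiffFun (fun z => f z * g z) := by
  obtain ⟨S, f', hf', hf⟩ := hf
  obtain ⟨T, g', hg', hg⟩ := hg
  obtain ⟨f₁, hf₁, hf⟩ := IsDiffFun.enlarge (Finset.subset_union_left (s₂ := T)) hf' hf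
  obtain ⟨g₁, hg₁, hg⟩ := IsDiffFun.enlarge (Finset.subset_union_right (s₁ := S)) hg' hg
  exact ⟨S ∪ T, fun w => f₁ w * g₁ w, hf₁.mul hg₁, fun z => by simp only [hf, hg]⟩

/-- The algebra of differential functions: smooth functions of `t`, `x`, `y` and finitely many
jet variables. -/
def diffFun : Subalgebra ℝ (Jet → ℝ) where
  carrier := {f | IsDiffFun f}
  mul_mem' hf hg := IsDiffFun.mul hf hg
  add_mem' hf hg := IsDiffFun.add hf hg
  algebraMap_mem' r := IsDiffFun.const r

/-- A coordinate as a differential function. -/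
def X (c : Coord) : diffFun := ⟨fun z => z c, IsDiffFun.coord c⟩

/-- Partial derivative of a function with respect to the coordinate `c`. -/
noncomputable def pd (c : Coord) (f : Jet → ℝ) (z : Jet) : ℝ :=
  deriv (fun s => f (Function.update z c s)) (z c)

theorem pd_eq_zero {f : Jet → ℝ} {S : Finset Coord} {g : ({c // c ∈ S} → ℝ) → ℝ}
    (hf : ∀ z : Jet, f z = g (fun c => z c.1)) {c : Coord} (hc : c ∉ S) (z : Jet) :
    pd c f z = 0 := by
  have h : (fun s => f (Function.update z c s)) = fun _ => f z := by
    funext s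
    rw [hf, hf]
    congr 1
    funext d
    exact Function.update_of_ne (fun h : d.1 = c => hc (h ▸ d.2)) _ _
  rw [pd, h, deriv_const]

theorem pd_eq_fderiv {f : Jet → ℝ} {S : Finset Coord} {g : ({c // c ∈ S} → ℝ) → ℝ}
    (hg : ContDiff ℝ ∞ g) (hf : ∀ z : Jet, f z = g (fun c => z c.1)) {c : Coord} (hc : c ∈ S)
    (z : Jet) : pd c f z = fderiv ℝ g (fun d => z d.1) (Pi.single ⟨c, hc⟩ 1) := by
  have h : (fun s => f (Function.update z c s)) =
      fun s => g (Function.update (fun d : {c // c ∈ S} => z d.1) ⟨c, hc⟩ s) := by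
    funext s
    rw [hf]
    congr 1
    funext d
    by_cases hd : d = ⟨c, hc⟩
    · subst hd; simp
    · rw [Function.update_of_ne hd, Function.update_of_ne]
      exact fun h => hd (Subtype.ext h)
  have h0 : Function.update (fun d : {c // c ∈ S} => z d.1) ⟨c, hc⟩ (z c) = fun d => z d.1 :=
    Function.update_eq_self (⟨c, hc⟩ : {c // c ∈ S}) (fun d => z d.1)
  have hd : HasFDerivAt g (fderiv ℝ g (fun d => z d.1))
      (Function.update (fun d : {c // c ∈ S} => z d.1) ⟨c, hc⟩ (z c)) := by
    rw [h0]
    exact ((hg.differentiable (by simp)) _).hasFDerivAt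
  rw [pd, h]
  exact (hd.comp_hasDerivAt (z c)
    (hasDerivAt_update (fun d : {c // c ∈ S} => z d.1) ⟨c, hc⟩ (z c))).deriv

theorem IsDiffFun.pd {f : Jet → ℝ} (hf : IsDiffFun f) (c : Coord) :
    IsDiffFun (Kolmogorov.pd c f) := by
  obtain ⟨S, g, hg, hf⟩ := hf
  by_cases hc : c ∈ S
  · refine ⟨S, fun w => fderiv ℝ g w (Pi.single ⟨c, hc⟩ 1), ?_, pd_eq_fderiv hg hf hc⟩
    exact (hg.fderiv_right (m := ∞) (by simp)).clm_apply contDiff_const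
  · have : Kolmogorov.pd c f = fun _ => 0 := funext (pd_eq_zero hf hc)
    rw [this]
    exact IsDiffFun.const 0

theorem pd_add {f g : Jet → ℝ} (hf : IsDiffFun f) (hg : IsDiffFun g) (c : Coord) (z : Jet) :
    pd c (f + g) z = pd c f z + pd c g z := by
  have key : ∀ {f : Jet → ℝ}, IsDiffFun f →
      DifferentiableAt ℝ (fun s => f (Function.update z c s)) (z c) := by
    rintro f ⟨S, h, hh, hf⟩
    simp only [hf]
    refine ((hh.differentiable (by simp)) _).comp (z c) ?_
    refine differentiableAt_pi.2 fun d => ?_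
    by_cases h : d.1 = c
    · simp only [h, Function.update_self]; exact differentiableAt_id
    · simp only [Function.update_of_ne h]; exact differentiableAt_const _
  exact deriv_fun_add (key hf) (key hg)

theorem pd_smul (r : ℝ) (f : Jet → ℝ) (c : Coord) (z : Jet) :
    pd c (r • f) z = r * pd c f z :=
  deriv_const_mul_field r

theorem support_finite {f : Jet → ℝ} (hf : IsDiffFun f) (V : Coord → Jet → ℝ) (z : Jet) :
    (Function.support fun c => V c z * pd c f z).Finite := by
  obtain ⟨S, g, -, hf⟩ := hf
  refine S.finite_toSet.subset fun c hc => ?_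
  by_contra h
  exact hc (by simp [pd_eq_zero hf h z])

/-- The vector field `∑_c V_c ∂_c` acting on differential functions; at each point only finitely
many terms of the sum are nonzero. -/
noncomputable def vectorField (V : Coord → diffFun) : Module.End ℝ diffFun where
  toFun f := ⟨fun z => ∑ᶠ c, (V c).1 z * pd c f.1 z, by
    obtain ⟨f, S, g, hg, hf⟩ := f
    have h : (fun z => ∑ᶠ c, (V c).1 z * pd c f z) =
        ∑ c ∈ S, fun z => (V c).1 z * pd c f z := by
      funext z
      rw [Finset.sum_apply]
      refine finsum_eq_sum_of_support_subset _ fun c hc => ?_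
      by_contra h
      exact hc (by simp [pd_eq_zero hf h z])
    change (fun z => ∑ᶠ c, (V c).1 z * pd c f z) ∈ diffFun
    rw [h]
    exact sum_mem fun c _ => IsDiffFun.mul (V c).2 (IsDiffFun.pd ⟨S, g, hg, hf⟩ c)⟩
  map_add' f g := by
    ext z
    change ∑ᶠ c, (V c).1 z * pd c (f.1 + g.1) z =
      ∑ᶠ c, (V c).1 z * pd c f.1 z + ∑ᶠ c, (V c).1 z * pd c g.1 z
    rw [← finsum_add_distrib (support_finite f.2 (fun c => (V c).1) z)
      (support_finite g.2 (fun c => (V c).1) z)]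
    exact finsum_congr fun c => by rw [pd_add f.2 g.2, mul_add]
  map_smul' r f := by
    ext z
    change ∑ᶠ c, (V c).1 z * pd c (r • f.1) z = r * ∑ᶠ c, (V c).1 z * pd c f.1 z
    rw [mul_finsum]
    exact finsum_congr fun c => by rw [pd_smul]; ring

/-- The total derivative in `x`, restricted to the equation:
`∂_x + ∑ u_{k+1,l} ∂_{u_{kl}}`. -/
noncomputable def Dx : Module.End ℝ diffFun :=
  vectorField fun
    | .t => 0
    | .x => 1
    | .y => 0
    | .u k l => X (.u (k + 1) l)

/-- The total derivative in `y`, restricted to the equation: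
`∂_y + ∑ u_{k,l+1} ∂_{u_{kl}}`. -/
noncomputable def Dy : Module.End ℝ diffFun :=
  vectorField fun
    | .t => 0
    | .x => 0
    | .y => 1
    | .u k l => X (.u k (l + 1))

/-- The total derivative in `t`, restricted to the equation:
`∂_t + ∑ (u_{k+2,l} - x u_{k,l+1} - k u_{k-1,l+1}) ∂_{u_{kl}}`
(for `k = 0` the last term vanishes because of its factor `k`). -/
noncomputable def Dt : Module.End ℝ diffFun :=
  vectorField fun
    | .t => 1
    | .x => 0
    | .y => 0
    | .u k l => X (.u (k + 2) l) - X .x * X (.u k (l + 1)) - (k : ℝ) • X (.u (k - 1) (l + 1))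

/-- The operator of multiplication by a differential function. -/
noncomputable def M (f : diffFun) : Module.End ℝ diffFun := LinearMap.mulLeft ℝ f

/-- The operator `F = D_t + x D_y - D_x²`. -/
noncomputable def F : Module.End ℝ diffFun := Dt + M (X .x) * Dy - Dx ^ 2

/-- The space of (characteristics of canonical representatives of) generalized symmetries of the
equation `u_t + x u_y = u_xx`. -/
noncomputable def genSym : Submodule ℝ diffFun := LinearMap.ker F

/-- A differential function that depends on the independent variables `t`, `x`, `y` only. -/
def IsCoefficient (f : diffFun) : Prop :=
  ∀ z w : Jet, z .t = w .t → z .x = w .x → z .y = w .y → f.1 z = f.1 w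

/-- Recursion operators: linear operators on differential functions that map characteristics of
generalized symmetries to characteristics of generalized symmetries. -/
noncomputable def recursionOps : Subalgebra ℝ (Module.End ℝ diffFun) where
  carrier := {Q | ∀ η ∈ genSym, Q η ∈ genSym}
  mul_mem' hQ hR η hη := hQ _ (hR η hη)
  add_mem' hQ hR η hη := add_mem (hQ η hη) (hR η hη)
  algebraMap_mem' r _ hη := genSym.smul_mem r hη

/-- Linear differential operators in the total derivatives `D_x`, `D_y` (the general form of such
operators once `D_t` is excluded by means of the equation) with coefficients depending only on
`t`, `x`, `y`. By the Leibniz rule these are exactly the finite sums of `a_{kl} D_x^k D_y^l`. -/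
noncomputable def diffOps : Subalgebra ℝ (Module.End ℝ diffFun) :=
  Algebra.adjoin ℝ ({Q | ∃ f, IsCoefficient f ∧ Q = M f} ∪ {Dx, Dy})

/-- Linear differential operators in all the total derivatives `D_t`, `D_x`, `D_y` with
coefficients depending only on `t`, `x`, `y`. -/
noncomputable def diffOpsT : Subalgebra ℝ (Module.End ℝ diffFun) :=
  Algebra.adjoin ℝ ({Q | ∃ f, IsCoefficient f ∧ Q = M f} ∪ {Dt, Dx, Dy})

/-- The algebra `Υ` of linear differential recursion operators, written in `D_x` and `D_y`. -/
noncomputable def Upsilon : Subalgebra ℝ (Module.End ℝ diffFun) := diffOps ⊓ recursionOps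

/-- Linear differential recursion operators that may also involve `D_t`. -/
noncomputable def UpsilonT : Subalgebra ℝ (Module.End ℝ diffFun) := diffOpsT ⊓ recursionOps

/-- `P⁰ = D_y`. -/
noncomputable def P0 : Module.End ℝ diffFun := Dy

/-- `P¹ = D_x + t D_y`. -/
noncomputable def P1 : Module.End ℝ diffFun := Dx + M (X .t) * Dy

/-- `P² = 2t D_x + t² D_y + x`. -/
noncomputable def P2 : Module.End ℝ diffFun :=
  M (2 * X .t) * Dx + M (X .t ^ 2) * Dy + M (X .x)

/-- `P³ = 3t² D_x + t³ D_y - 3(y - tx)`. -/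
noncomputable def P3 : Module.End ℝ diffFun :=
  M (3 * X .t ^ 2) * Dx + M (X .t ^ 3) * Dy - M (3 * (X .y - X .t * X .x))

/-- The (unital) associative algebra `Υ_r` generated by `P⁰`, `P¹`, `P²`, `P³`. -/
noncomputable def UpsilonR : Subalgebra ℝ (Module.End ℝ diffFun) :=
  Algebra.adjoin ℝ {P0, P1, P2, P3}

end Kolmogorov

set_option maxSynthPendingDepth 3

/-! An operator in `Dx`, `Dy` has a unique normal form `∑ a_{kl} Dx^k Dy^l`, because `∂_{u_kl}`
applied to its value on `u` returns `a_{kl}`. Hence it is determined by its value on the single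
symmetry `u`. For `Q ∈ Υ` the commutator `[F, Q]` is again an operator in `Dx`, `Dy` and it kills
`u`, so `Q` commutes with `F` on all differential functions (`commute_F_of_mem_Upsilon`). The
problem becomes computing the commutant of `F`.

The coefficients of such a `Q` satisfy a triangular system (`IsCommutantSystem`). Together with
`[Dx, F] = Dy`, it forces powers of `Dx` and of `Dy` to annihilate every coefficient, so no prior
knowledge of polynomiality is needed. Consequently `ad P0` is locally nilpotent on the commutant,
and `ad P1` on the kernel of `ad P0`.

Since `[P0, P3] = -3` and `[P1, P2] = 1`, the slice argument `le_of_slice`, used twice, expresses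
the commutant through `P3`, `P2` and the operators commuting with `P0` and `P1`. The latter have
coefficients depending on `t` alone, which solve a linear ODE system. They are fixed by their values
at `t = 0`, where `P1^k P0^l` looks like `Dx^k Dy^l`, so they are polynomials in `P1` and `P0`
(`mem_UpsilonR_of_commute`). -/

namespace Kolmogorov

/-! ### Partial derivatives and vector fields on the jet space -/

theorem IsDiffFun.differentiableAt_update {f : Jet → ℝ} (hf : IsDiffFun f) (z : Jet) (c : Coord)
    (s : ℝ) : DifferentiableAt ℝ (fun s => f (Function.update z c s)) s := by
  obtain ⟨S, h, hh, hf⟩ := hf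
  simp only [hf]
  refine ((hh.differentiable (by simp)) _).comp s ?_
  refine differentiableAt_pi.2 fun d => ?_
  by_cases h : d.1 = c
  · simp only [h, Function.update_self]; exact differentiableAt_id
  · simp only [Function.update_of_ne h]; exact differentiableAt_const _

theorem pd_mul {f g : Jet → ℝ} (hf : IsDiffFun f) (hg : IsDiffFun g) (c : Coord) (z : Jet) :
    pd c (f * g) z = pd c f z * g z + f z * pd c g z := by
  have h := deriv_fun_mul (hf.differentiableAt_update z c (z c))
    (hg.differentiableAt_update z c (z c))
  rw [Function.update_eq_self] at h
  exact h

theorem pd_comm {f : Jet → ℝ} (hf : IsDiffFun f) (c d : Coord) (z : Jet) :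
    pd c (pd d f) z = pd d (pd c f) z := by
  obtain ⟨S, g, hg, hf⟩ := hf
  have hzero : ∀ {c d : Coord}, c ∉ S → pd c (pd d f) z = pd d (pd c f) z := by
    intro c d hc
    have h1 : pd c f = fun _ => 0 := funext (pd_eq_zero hf hc)
    have h2 : pd d (fun _ => (0 : ℝ)) z = 0 := deriv_const _ _
    rw [h1, h2]
    by_cases hd : d ∈ S
    · exact pd_eq_zero (g := fun w => fderiv ℝ g w (Pi.single ⟨d, hd⟩ 1))
        (pd_eq_fderiv hg hf hd) hc z
    · rw [show pd d f = fun _ => 0 from funext (pd_eq_zero hf hd)]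
      exact deriv_const _ _
  by_cases hc : c ∈ S
  swap
  · exact hzero hc
  by_cases hd : d ∈ S
  swap
  · exact (hzero hd).symm
  have h1 : ContDiff ℝ ∞ (fderiv ℝ g) := hg.fderiv_right (m := ∞) (by simp)
  have key : ∀ {c d : Coord} (hc : c ∈ S) (hd : d ∈ S), pd c (pd d f) z =
      fderiv ℝ (fderiv ℝ g) (fun e => z e.1) (Pi.single ⟨c, hc⟩ 1) (Pi.single ⟨d, hd⟩ 1) := by
    intro c d hc hd
    rw [pd_eq_fderiv (g := fun w => fderiv ℝ g w (Pi.single ⟨d, hd⟩ 1))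
      (h1.clm_apply contDiff_const) (pd_eq_fderiv hg hf hd) hc z]
    rw [fderiv_clm_apply ((h1.differentiable (by simp)) _) (differentiableAt_const _)]
    simp
  rw [key hc hd, key hd hc]
  exact (hg.contDiffAt.isSymmSndFDerivAt 
    (by simpa using WithTop.coe_le_coe.2 (le_top : (2 : ℕ∞) ≤ ⊤))) _ _

theorem coe_vectorField (V : Coord → diffFun) (f : diffFun) (z : Jet) :
    (vectorField V f).1 z = ∑ᶠ c, (V c).1 z * pd c f.1 z := rfl

theorem vectorField_mul (V : Coord → diffFun) (f g : diffFun) :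
    vectorField V (f * g) = vectorField V f * g + f * vectorField V g := by
  ext z
  change ∑ᶠ c, (V c).1 z * pd c (f.1 * g.1) z =
    (∑ᶠ c, (V c).1 z * pd c f.1 z) * g.1 z + f.1 z * ∑ᶠ c, (V c).1 z * pd c g.1 z
  have hf := support_finite f.2 (fun c => (V c).1) z
  have hg := support_finite g.2 (fun c => (V c).1) z
  rw [finsum_mul' _ _ hf, mul_finsum' _ _ hg, ← finsum_add_distrib]
  · exact finsum_congr fun c => by rw [pd_mul f.2 g.2]; ring
  · exact hf.subset fun c hc h => hc (by simp only [h, zero_mul])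
  · exact hg.subset fun c hc h => hc (by simp only [h, mul_zero])

/-- The partial derivative with respect to a coordinate, as an operator on differential
functions. -/
noncomputable def partialDeriv (c : Coord) : Module.End ℝ diffFun := vectorField (Pi.single c 1)

theorem coe_partialDeriv (c : Coord) (f : diffFun) (z : Jet) :
    (partialDeriv c f).1 z = pd c f.1 z := by
  rw [partialDeriv, coe_vectorField, finsum_eq_single _ c]
  · simp
  · intro d hd
    simp [Pi.single_eq_of_ne hd]

theorem pd_coord (c d : Coord) (z : Jet) :
    pd c (fun w => w d) z = (Pi.single c 1 : Coord → ℝ) d := by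
  by_cases h : d = c
  · subst h; simp [pd]
  · simp [pd, Function.update_of_ne h, Pi.single_eq_of_ne h]

theorem vectorField_X (V : Coord → diffFun) (c : Coord) : vectorField V (X c) = V c := by
  ext z
  rw [coe_vectorField, finsum_eq_single _ c]
  · simp [X, pd_coord]
  · intro d hd
    simp [X, pd_coord, Pi.single_eq_of_ne hd.symm]

/-- A vector field acts on a given differential function through finitely many partial
derivatives, with all the functions depending on the same coordinates. -/
theorem exists_vectorField_eq_sum (f : diffFun) : ∃ S : Finset Coord,
    (∀ V, vectorField V f = ∑ c ∈ S, V c * partialDeriv c f) ∧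
    ∀ V d, vectorField V (partialDeriv d f) =
      ∑ c ∈ S, V c * partialDeriv c (partialDeriv d f) := by
  obtain ⟨f, S, g, hg, hf⟩ := f
  have hpd : ∀ d, ∃ g' : ({c // c ∈ S} → ℝ) → ℝ, ∀ z, pd d f z = g' (fun c => z c.1) := by
    intro d
    by_cases hd : d ∈ S
    · exact ⟨fun w => fderiv ℝ g w (Pi.single ⟨d, hd⟩ 1), pd_eq_fderiv hg hf hd⟩
    · exact ⟨fun _ => 0, pd_eq_zero hf hd⟩
  have key : ∀ (h : diffFun) (g' : ({c // c ∈ S} → ℝ) → ℝ),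
      (∀ z, h.1 z = g' (fun c => z c.1)) → ∀ V, vectorField V h = ∑ c ∈ S, V c * partialDeriv c h := by
    intro h g' hg' V
    ext z
    rw [coe_vectorField, finsum_eq_sum_of_support_subset (s := S)]
    · rw [AddSubmonoidClass.coe_finsetSum, Finset.sum_apply]
      exact Finset.sum_congr rfl fun c _ => by rw [← coe_partialDeriv]; rfl
    · intro c hc
      by_contra h0
      exact hc (by simp [pd_eq_zero hg' h0 z])
  refine ⟨S, key _ g hf, fun V d => ?_⟩
  obtain ⟨g', hg'⟩ := hpd d
  exact key _ g' (fun z => (coe_partialDeriv d _ z).trans (hg' z)) V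

theorem partialDeriv_comm (c d : Coord) (f : diffFun) :
    partialDeriv c (partialDeriv d f) = partialDeriv d (partialDeriv c f) := by
  have h : ∀ c, (partialDeriv c f).1 = pd c f.1 := fun c => funext (coe_partialDeriv c f)
  ext z
  rw [coe_partialDeriv, coe_partialDeriv, h, h, pd_comm f.2]

/-- The second-order terms cancel by symmetry of mixed partials, leaving the Lie bracket.
Commutation of total derivatives thereby reduces to a check on coordinates. -/
theorem vectorField_commutator (V W : Coord → diffFun) (f : diffFun) :
    vectorField V (vectorField W f) = vectorField W (vectorField V f) +
      vectorField (fun c => vectorField V (W c) - vectorField W (V c)) f := by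
  obtain ⟨S, h1, h2⟩ := exists_vectorField_eq_sum f
  rw [h1 V, h1 W, h1, map_sum, map_sum]
  simp only [vectorField_mul, h2, Finset.sum_add_distrib, Finset.mul_sum, sub_mul,
    Finset.sum_sub_distrib]
  rw [Finset.sum_comm (s := S) (t := S) (f := fun i j => V i * (W j * _))]
  have h3 : ∑ c ∈ S, ∑ d ∈ S, W c * (V d * partialDeriv d (partialDeriv c f)) =
      ∑ d ∈ S, ∑ c ∈ S, V d * (W c * partialDeriv c (partialDeriv d f)) := by
    rw [Finset.sum_comm]
    exact Finset.sum_congr rfl fun d _ => Finset.sum_congr rfl fun c _ => by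
      rw [partialDeriv_comm]; ring
  rw [h3, Finset.sum_comm]
  ring

theorem vectorField_one (V : Coord → diffFun) : vectorField V 1 = 0 := by
  have h := vectorField_mul V 1 1
  simpa using h

theorem vectorField_natCast (V : Coord → diffFun) (n : ℕ) :
    vectorField V (n : diffFun) = 0 := by
  rw [← mul_one (n : diffFun), ← nsmul_eq_mul, map_nsmul, vectorField_one, nsmul_zero]

theorem vectorField_zero : vectorField 0 = 0 := by
  ext f z
  change ∑ᶠ c, (0 : ℝ) * pd c f.1 z = 0
  simp

theorem vectorField_add (V W : Coord → diffFun) :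
    vectorField (V + W) = vectorField V + vectorField W := by
  refine LinearMap.ext fun f => ?_
  obtain ⟨S, h, -⟩ := exists_vectorField_eq_sum f
  simp [h, add_mul, Finset.sum_add_distrib]

theorem vectorField_mul_left (g : diffFun) (V : Coord → diffFun) (f : diffFun) :
    vectorField (fun c => g * V c) f = g * vectorField V f := by
  obtain ⟨S, h, -⟩ := exists_vectorField_eq_sum f
  simp [h, Finset.mul_sum, mul_assoc]

/-! ### Total derivatives and the relations among `F`, `P0`, `P1`, `P2`, `P3` -/

theorem Dx_mul (f g : diffFun) : Dx (f * g) = Dx f * g + f * Dx g := vectorField_mul _ f g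
theorem Dy_mul (f g : diffFun) : Dy (f * g) = Dy f * g + f * Dy g := vectorField_mul _ f g
theorem Dt_mul (f g : diffFun) : Dt (f * g) = Dt f * g + f * Dt g := vectorField_mul _ f g

theorem Dx_natCast (n : ℕ) : Dx (n : diffFun) = 0 := vectorField_natCast _ n
theorem Dy_natCast (n : ℕ) : Dy (n : diffFun) = 0 := vectorField_natCast _ n
theorem Dt_natCast (n : ℕ) : Dt (n : diffFun) = 0 := vectorField_natCast _ n

theorem Dx_one : Dx (1 : diffFun) = 0 := vectorField_one _
theorem Dx_two : Dx (2 : diffFun) = 0 := Dx_natCast 2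
theorem Dy_two : Dy (2 : diffFun) = 0 := Dy_natCast 2
theorem Dt_two : Dt (2 : diffFun) = 0 := Dt_natCast 2
theorem Dx_three : Dx (3 : diffFun) = 0 := Dx_natCast 3
theorem Dy_three : Dy (3 : diffFun) = 0 := Dy_natCast 3
theorem Dt_three : Dt (3 : diffFun) = 0 := Dt_natCast 3

theorem Dx_X_t : Dx (X .t) = 0 := vectorField_X _ _
theorem Dx_X_x : Dx (X .x) = 1 := vectorField_X _ _
theorem Dx_X_y : Dx (X .y) = 0 := vectorField_X _ _
theorem Dx_X_u (k l : ℕ) : Dx (X (.u k l)) = X (.u (k + 1) l) := vectorField_X _ _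
theorem Dy_X_t : Dy (X .t) = 0 := vectorField_X _ _
theorem Dy_X_x : Dy (X .x) = 0 := vectorField_X _ _
theorem Dy_X_y : Dy (X .y) = 1 := vectorField_X _ _
theorem Dy_X_u (k l : ℕ) : Dy (X (.u k l)) = X (.u k (l + 1)) := vectorField_X _ _
theorem Dt_X_t : Dt (X .t) = 1 := vectorField_X _ _
theorem Dt_X_x : Dt (X .x) = 0 := vectorField_X _ _
theorem Dt_X_y : Dt (X .y) = 0 := vectorField_X _ _
theorem Dt_X_u (k l : ℕ) : Dt (X (.u k l)) =
    X (.u (k + 2) l) - X .x * X (.u k (l + 1)) - (k : diffFun) * X (.u (k - 1) (l + 1)) := by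
  refine (vectorField_X _ _).trans ?_
  rw [← nsmul_eq_mul, ← Nat.cast_smul_eq_nsmul ℝ]

/-- The coefficients of the vector field `D_x`. -/
noncomputable def xField : Coord → diffFun
  | .t => 0
  | .x => 1
  | .y => 0
  | .u k l => X (.u (k + 1) l)

/-- The coefficients of the vector field `D_y`. -/
noncomputable def yField : Coord → diffFun
  | .t => 0
  | .x => 0
  | .y => 1
  | .u k l => X (.u k (l + 1))

/-- The coefficients of the vector field `D_t`. -/
noncomputable def tField : Coord → diffFun
  | .t => 1
  | .x => 0
  | .y => 0
  | .u k l => X (.u (k + 2) l) - X .x * X (.u k (l + 1)) - (k : diffFun) * X (.u (k - 1) (l + 1))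

theorem Dx_eq : Dx = vectorField xField := by
  rw [Dx]; congr 1

theorem Dy_eq : Dy = vectorField yField := by
  rw [Dy]; congr 1

theorem Dt_eq : Dt = vectorField tField := by
  rw [Dt]; congr 1

theorem vectorField_comm {V W : Coord → diffFun}
    (h : ∀ c, vectorField V (W c) = vectorField W (V c)) (f : diffFun) :
    vectorField V (vectorField W f) = vectorField W (vectorField V f) := by
  rw [vectorField_commutator V W, add_eq_left]
  have h0 : (fun c => vectorField V (W c) - vectorField W (V c)) = 0 :=
    funext fun c => sub_eq_zero.2 (h c)
  rw [h0, vectorField_zero, LinearMap.zero_apply]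

theorem Dx_Dy (f : diffFun) : Dx (Dy f) = Dy (Dx f) := by
  rw [Dx_eq, Dy_eq]
  refine vectorField_comm (fun c => ?_) f
  rw [← Dx_eq, ← Dy_eq]
  cases c
  case u k l => simp only [xField, yField, Dx_X_u, Dy_X_u]
  all_goals simp [xField, yField, Dx_eq, Dy_eq, vectorField_one]

theorem Dt_Dy (f : diffFun) : Dt (Dy f) = Dy (Dt f) := by
  rw [Dt_eq, Dy_eq]
  refine vectorField_comm (fun c => ?_) f
  rw [← Dt_eq, ← Dy_eq]
  cases c
  case u k l =>
    simp only [tField, yField, Dt_X_u, Dy_X_u, Dy_mul, map_sub, Dy_X_x, Dy_natCast]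
    ring
  all_goals simp [tField, yField, Dt_eq, Dy_eq, vectorField_one]

theorem Dt_Dx (f : diffFun) : Dt (Dx f) = Dx (Dt f) := by
  rw [Dt_eq, Dx_eq]
  refine vectorField_comm (fun c => ?_) f
  rw [← Dt_eq, ← Dx_eq]
  cases c
  case u k l =>
    simp only [tField, xField, Dt_X_u, Dx_X_u, Dx_mul, map_sub, Dx_X_x, Dx_natCast]
    -- The truncated index `k - 1` is harmless at `k = 0`, where its factor `k` vanishes.
    rcases k with _ | k
    · push_cast; ring
    · push_cast [Nat.add_sub_cancel]; ring
  all_goals simp [tField, xField, Dt_eq, Dx_eq, vectorField_one]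

theorem F_apply (f : diffFun) : F f = Dt f + X .x * Dy f - Dx (Dx f) := rfl

theorem commute_F_P0 : Commute F P0 := LinearMap.ext fun f => by
  change F (Dy f) = Dy (F f)
  simp only [F_apply, map_add, map_sub, Dy_mul, Dy_X_x, Dt_Dy, Dx_Dy]
  ring

theorem P1_apply (f : diffFun) : P1 f = Dx f + X .t * Dy f := rfl
theorem P2_apply (f : diffFun) : P2 f = 2 * X .t * Dx f + X .t ^ 2 * Dy f + X .x * f := rfl
theorem P3_apply (f : diffFun) : P3 f = 3 * X .t ^ 2 * Dx f + X .t ^ 3 * Dy f -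
    3 * (X .y - X .t * X .x) * f := rfl

theorem commute_F_P1 : Commute F P1 := LinearMap.ext fun f => by
  change F (P1 f) = P1 (F f)
  simp only [F_apply, P1_apply, map_add, map_sub, Dy_mul, Dx_mul, Dt_mul, Dt_X_t, Dx_X_t, Dy_X_t,
    Dy_X_x, Dx_X_x, Dt_Dy, Dt_Dx, Dx_Dy, map_zero]
  ring

theorem commute_F_P2 : Commute F P2 := LinearMap.ext fun f => by
  change F (P2 f) = P2 (F f)
  simp only [F_apply, P2_apply, map_add, map_sub, Dy_mul, Dx_mul, Dt_mul, Dt_X_t, Dx_X_t, Dy_X_t,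
    Dy_X_x, Dx_X_x, Dt_X_x, Dt_Dy, Dt_Dx, Dx_Dy, pow_succ, pow_zero, one_mul, Dx_two, Dy_two,
    Dt_two, map_zero]
  ring

theorem commute_F_P3 : Commute F P3 := LinearMap.ext fun f => by
  change F (P3 f) = P3 (F f)
  simp only [F_apply, P3_apply, map_add, map_sub, Dy_mul, Dx_mul, Dt_mul, Dt_X_t, Dx_X_t, Dy_X_t,
    Dy_X_x, Dx_X_x, Dt_X_x, Dx_X_y, Dy_X_y, Dt_X_y, Dt_Dy, Dt_Dx, Dx_Dy, pow_succ, pow_zero,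
    one_mul, Dx_three, Dy_three, Dt_three, map_zero, Dx_one]
  ring

/-- This relation and `P1_mul_P2` make `P3` and `P2` slices for `ad P0` and `ad P1`. -/
theorem P0_mul_P3 : P0 * P3 = P3 * P0 - 3 := LinearMap.ext fun f => by
  change Dy (P3 f) = P3 (Dy f) - (3 : Module.End ℝ diffFun) f
  have h : (3 : Module.End ℝ diffFun) f = 3 * f := by
    rw [Module.End.ofNat_apply, ← Nat.cast_smul_eq_nsmul diffFun]; rfl
  simp only [h, P3_apply, map_add, map_sub, Dy_mul, Dy_X_t, Dy_X_x, Dy_X_y, Dx_Dy, pow_succ,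
    pow_zero, one_mul, Dy_three]
  ring

theorem P1_mul_P2 : P1 * P2 = P2 * P1 + 1 := LinearMap.ext fun f => by
  change P1 (P2 f) = P2 (P1 f) + f
  simp only [P1_apply, P2_apply, map_add, Dy_mul, Dx_mul, Dx_X_t, Dy_X_t,
    Dy_X_x, Dx_X_x, Dx_Dy, pow_succ, pow_zero, one_mul, Dx_two, Dy_two]
  ring

theorem commute_P0_P1 : Commute P0 P1 := LinearMap.ext fun f => by
  change Dy (P1 f) = P1 (Dy f)
  simp only [P1_apply, map_add, Dy_mul, Dy_X_t, Dx_Dy]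
  ring

theorem commute_P0_P2 : Commute P0 P2 := LinearMap.ext fun f => by
  change Dy (P2 f) = P2 (Dy f)
  simp only [P2_apply, map_add, Dy_mul, Dy_X_t, Dy_X_x, Dx_Dy, pow_succ, pow_zero, one_mul,
    Dy_two]
  ring

/-! ### Commuting jet partial derivatives past `F` -/

theorem partialDeriv_mul (c : Coord) (f g : diffFun) :
    partialDeriv c (f * g) = partialDeriv c f * g + f * partialDeriv c g :=
  vectorField_mul _ f g

theorem partialDeriv_X (c d : Coord) :
    partialDeriv c (X d) = (Pi.single c 1 : Coord → diffFun) d := vectorField_X _ _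

theorem partialDeriv_natCast (c : Coord) (n : ℕ) : partialDeriv c (n : diffFun) = 0 :=
  vectorField_natCast _ n

theorem partialDeriv_one (c : Coord) : partialDeriv c (1 : diffFun) = 0 :=
  vectorField_one _

theorem partialDeriv_vectorField (c : Coord) (V : Coord → diffFun) (f : diffFun) :
    partialDeriv c (vectorField V f) = vectorField V (partialDeriv c f) +
      vectorField (fun d => partialDeriv c (V d)) f := by
  rw [partialDeriv, vectorField_commutator]
  congr 3
  funext d
  rw [sub_eq_self]
  by_cases h : d = c
  · subst h; rw [Pi.single_eq_same, vectorField_one]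
  · rw [Pi.single_eq_of_ne h, map_zero]

theorem partialDeriv_u_zero_Dx (l : ℕ) (f : diffFun) :
    partialDeriv (.u 0 l) (Dx f) = Dx (partialDeriv (.u 0 l) f) := by
  rw [Dx_eq, partialDeriv_vectorField, add_eq_left]
  have h : (fun d => partialDeriv (.u 0 l) (xField d)) = 0 := by
    funext d
    cases d <;> simp [xField, partialDeriv_X, partialDeriv_one]
  rw [h, vectorField_zero, LinearMap.zero_apply]

/-- The variable `u_{k+1,l}` occurs in exactly one coefficient of `Dx`, that of `∂_{u_kl}`. -/
theorem partialDeriv_u_succ_Dx (k l : ℕ) (f : diffFun) :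
    partialDeriv (.u (k + 1) l) (Dx f) =
      Dx (partialDeriv (.u (k + 1) l) f) + partialDeriv (.u k l) f := by
  rw [Dx_eq, partialDeriv_vectorField, add_right_inj, partialDeriv.eq_1 (.u k l)]
  congr 2
  funext d
  cases d <;> simp [xField, partialDeriv_X, partialDeriv_one, Pi.single_apply]

/-- The contribution of index `(k, l)` in the term `∑ (k + 1) a (k + 1) l ∂_x^k ∂_y^(l + 1)`. -/
def lowerTerm {E : Type*} [AddCommGroup E] (a : ℕ → ℕ → E) (k : ℕ) : ℕ → E
  | 0 => 0
  | l + 1 => (k + 1) • a (k + 1) l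

/-- The contribution of index `(k, l)` in the term `∑ a k l ∂_x^(k + 2) ∂_y^l`. -/
def shiftTwo {E : Type*} [AddCommGroup E] (a : ℕ → ℕ → E) : ℕ → ℕ → E
  | 0, _ => 0
  | 1, _ => 0
  | k + 2, l => a k l

/-- The partial derivatives in the jet variables, as vector fields. -/
noncomputable def jetField (k l : ℕ) : Coord → diffFun := Pi.single (.u k l) 1

theorem jetField_u (k l i j : ℕ) : jetField k l (.u i j) = if i = k ∧ j = l then 1 else 0 := by
  simp [jetField, Pi.single_apply]

theorem jetField_eq_zero (k l : ℕ) {d : Coord} (hd : ∀ i j, d ≠ .u i j) : jetField k l d = 0 :=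
  Pi.single_eq_of_ne (hd k l) _

theorem shiftTwo_jetField_u (k l i j : ℕ) :
    shiftTwo jetField k l (.u i j) = jetField k l (.u (i + 2) j) := by
  rcases k with _ | _ | k <;> simp [shiftTwo, jetField_u]

theorem lowerTerm_jetField_u (k l i j : ℕ) :
    lowerTerm jetField k l (.u i j) = (i : diffFun) * jetField k l (.u (i - 1) (j + 1)) := by
  rcases l with _ | l
  · simp [lowerTerm, jetField_u]
  · simp only [lowerTerm, Pi.smul_apply, jetField_u, nsmul_eq_mul]
    rcases i with _ | i
    · simp
    · by_cases hik : i = k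
      · subst hik; simp
      · simp [hik]

theorem shiftTwo_jetField_eq_zero (k l : ℕ) {d : Coord} (hd : ∀ i j, d ≠ .u i j) :
    shiftTwo jetField k l d = 0 := by
  rcases k with _ | _ | k
  · rfl
  · rfl
  · exact jetField_eq_zero _ _ hd

theorem lowerTerm_jetField_eq_zero (k l : ℕ) {d : Coord} (hd : ∀ i j, d ≠ .u i j) :
    lowerTerm jetField k l d = 0 := by
  rcases l with _ | l
  · rfl
  · rw [lowerTerm, Pi.smul_apply, jetField_eq_zero _ _ hd, smul_zero]

/-- The terms `x u_{i,j+1}` cancel between `Dt` and `x Dy`. What remains along `∂_{u_ij}` is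
`u_{i+2,j} - i u_{i-1,j+1}`, linear with constant coefficients. -/
theorem partialDeriv_u_transportField (k l : ℕ) (d : Coord) :
    partialDeriv (.u k l) (tField d + X .x * yField d) =
      shiftTwo jetField k l d + (-1) * lowerTerm jetField k l d := by
  have hX : partialDeriv (.u k l) (X .x) = 0 := by
    rw [partialDeriv_X]; exact jetField_eq_zero k l (by simp)
  have hU : ∀ i j, partialDeriv (.u k l) (X (.u i j)) = jetField k l (.u i j) :=
    fun i j => partialDeriv_X _ _
  rcases d with _ | _ | _ | ⟨i, j⟩
  case u =>
    simp only [tField, yField, map_add, map_sub, partialDeriv_mul,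
      partialDeriv_natCast, hX, zero_mul, zero_add, hU, shiftTwo_jetField_u, lowerTerm_jetField_u]
    ring
  all_goals
    rw [shiftTwo_jetField_eq_zero _ _ (by simp), lowerTerm_jetField_eq_zero _ _ (by simp)]
    simp only [tField, yField, map_add, partialDeriv_mul, hX, partialDeriv_one, map_zero,
      mul_zero, zero_mul, add_zero]

theorem partialDeriv_u_transport (k l : ℕ) (f : diffFun) :
    partialDeriv (.u k l) (Dt f + X .x * Dy f) =
      Dt (partialDeriv (.u k l) f) + X .x * Dy (partialDeriv (.u k l) f) +
        shiftTwo (fun k l => partialDeriv (.u k l) f) k l -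
        lowerTerm (fun k l => partialDeriv (.u k l) f) k l := by
  have hT : ∀ g, Dt g + X .x * Dy g = vectorField (tField + fun c => X .x * yField c) g := by
    intro g
    rw [vectorField_add, LinearMap.add_apply, vectorField_mul_left, Dt_eq, Dy_eq]
  rw [hT, hT, partialDeriv_vectorField, add_sub_assoc, add_right_inj]
  have h : (fun d => partialDeriv (.u k l) ((tField + fun c => X .x * yField c) d)) =
      shiftTwo jetField k l + fun c => (-1 : diffFun) * lowerTerm jetField k l c :=
    funext (partialDeriv_u_transportField k l)
  have hsub : ∀ a b : diffFun, a + (-1) * b = a - b := fun a b => by ring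
  rw [h, vectorField_add, LinearMap.add_apply, vectorField_mul_left, hsub]
  congr 1
  · rcases k with _ | _ | k
    · simp only [shiftTwo, vectorField_zero, LinearMap.zero_apply]
    · simp only [shiftTwo, vectorField_zero, LinearMap.zero_apply]
    · rfl
  · rcases l with _ | l
    · simp only [lowerTerm, vectorField_zero, LinearMap.zero_apply]
    · simp only [lowerTerm, nsmul_eq_mul]
      exact vectorField_mul_left _ _ _

theorem partialDeriv_u_zero_F (l : ℕ) (f : diffFun) :
    partialDeriv (.u 0 l) (F f) = F (partialDeriv (.u 0 l) f) -
      lowerTerm (fun k l => partialDeriv (.u k l) f) 0 l := by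
  rw [F_apply, map_sub, partialDeriv_u_transport, partialDeriv_u_zero_Dx, partialDeriv_u_zero_Dx,
    F_apply]
  simp only [shiftTwo]
  ring

/-- Moving `∂_{u_{k+1,l}}` past `Dx²` produces `2 Dx ∂_{u_kl}` and `∂_{u_{k-1,l}}`; the latter
cancels the `shiftTwo` term coming from `Dt`. -/
theorem partialDeriv_u_succ_F (k l : ℕ) (f : diffFun) :
    partialDeriv (.u (k + 1) l) (F f) = F (partialDeriv (.u (k + 1) l) f) -
      2 • Dx (partialDeriv (.u k l) f) -
      lowerTerm (fun k l => partialDeriv (.u k l) f) (k + 1) l := by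
  rw [F_apply, map_sub, partialDeriv_u_transport, partialDeriv_u_succ_Dx, partialDeriv_u_succ_Dx,
    F_apply, map_add]
  rcases k with _ | k
  · rw [partialDeriv_u_zero_Dx]
    simp only [shiftTwo]
    ring
  · rw [partialDeriv_u_succ_Dx]
    simp only [shiftTwo]
    ring

/-! ### Nilpotency forced by the coefficient system -/

section Nilpotency

variable {E : Type*} [AddCommGroup E] [Module ℝ E]

/-- The system of equations on the coefficients `a k l` of `∑ a k l A^k B^l` expressing that this
operator commutes with `T`. -/
structure IsCommutantSystem (T A : Module.End ℝ E) (a : ℕ → ℕ → E) : Prop where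
  zero : ∀ l, T (a 0 l) = lowerTerm a 0 l
  succ : ∀ k l, T (a (k + 1) l) = (2 : ℝ) • A (a k l) + lowerTerm a (k + 1) l

theorem IsCommutantSystem.map {T A B : Module.End ℝ E} {a : ℕ → ℕ → E}
    (h : IsCommutantSystem T A a) (hT : Commute T B) (hA : Commute A B) :
    IsCommutantSystem T A fun k l => B (a k l) := by
  have hTB : ∀ v, T (B v) = B (T v) := fun v => LinearMap.congr_fun hT.eq v
  have hAB : ∀ v, A (B v) = B (A v) := fun v => LinearMap.congr_fun hA.eq v
  have hl : ∀ k l, lowerTerm (fun k l => B (a k l)) k l = B (lowerTerm a k l) := by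
    rintro k (_ | l)
    · simp [lowerTerm]
    · simp only [lowerTerm, map_nsmul]
  exact ⟨fun l => by rw [hTB, h.zero, hl], fun k l => by
    rw [hTB, h.succ, hl, hAB, map_add, map_smul]⟩

theorem pow_succ_mul_of_commutator {T A B : Module.End ℝ E} (hAT : A * T = T * A + B)
    (hAB : Commute A B) (j : ℕ) :
    A ^ (j + 1) * T = T * A ^ (j + 1) + ((j : ℝ) + 1) • (B * A ^ j) := by
  induction j with
  | zero => simp [hAT]
  | succ j ih =>
    rw [pow_succ' A (j + 1), mul_assoc, ih, mul_add, ← mul_assoc, hAT, add_mul, mul_smul_comm,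
      ← mul_assoc A B, hAB.eq, mul_assoc B A, ← pow_succ', add_assoc, mul_assoc]
    congr 1
    push_cast
    module

variable {T A B : Module.End ℝ E} {a : ℕ → ℕ → E}

/-- Downward induction on the degree `k + l = n - m`. Apply `A^(2m+1)` to the equation for
`a_{k+1,l}`: by induction it kills `a_{k+1,l}` and the lower term, which has the same degree.
Commuting it past `T` therefore leaves `2 A^(2m+2) a_{kl} = (2m+1) B A^(2m) a_{k+1,l}`, and one
further `A` gives zero because `A` commutes with `B`. -/
theorem IsCommutantSystem.pow_apply (h : IsCommutantSystem T A a) (hAT : A * T = T * A + B)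
    (hAB : Commute A B) {n : ℕ} (hn : ∀ k l, n < k + l → a k l = 0) (m : ℕ) :
    ∀ k l, k + l + m = n → (A ^ (2 * m + 1)) (a k l) = 0 ∧
      ∃ c : ℝ, c ≠ 0 ∧ (A ^ (2 * m)) (a k l) = c • (B ^ m) (a (k + m) l) := by
  induction m with
  | zero =>
    intro k l hkl
    refine ⟨?_, 1, one_ne_zero, by simp⟩
    -- In top degree, both `a_{k+1,l}` and the lower term have degree above `n`, so the equation
    -- reads `2 A a_{kl} = 0`.
    have h1 := h.succ k l
    rw [hn (k + 1) l (by omega), map_zero] at h1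
    have h2 : lowerTerm a (k + 1) l = 0 := by
      rcases l with _ | l
      · rfl
      · rw [lowerTerm, hn _ _ (by omega), smul_zero]
    rw [h2, add_zero] at h1
    simpa using h1.symm
  | succ m ih =>
    intro k l hkl
    obtain ⟨h1, c, hc, h2⟩ := ih (k + 1) l (by omega)
    have h3 : (A ^ (2 * m + 1)) (lowerTerm a (k + 1) l) = 0 := by
      rcases l with _ | l
      · simp [lowerTerm]
      · rw [lowerTerm, map_nsmul, (ih (k + 1 + 1) l (by omega)).1, smul_zero]
    have h4 := LinearMap.congr_fun (pow_succ_mul_of_commutator hAT hAB (2 * m)) (a (k + 1) l)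
    simp only [Module.End.mul_apply, LinearMap.add_apply, LinearMap.smul_apply] at h4
    rw [h.succ, h1, h2, map_add, h3, map_zero, zero_add, add_zero, map_smul,
      ← Module.End.mul_apply, ← pow_succ, map_smul, smul_smul, ← Module.End.mul_apply,
      ← pow_succ'] at h4
    have h5 : (A ^ (2 * (m + 1))) (a k l) =
        ((2 : ℝ)⁻¹ * (((2 * m : ℕ) : ℝ) + 1) * c) • (B ^ (m + 1)) (a (k + (m + 1)) l) := by
      rw [show 2 * (m + 1) = 2 * m + 1 + 1 by ring, mul_assoc, mul_smul,
        show k + (m + 1) = k + 1 + m by ring, ← h4, smul_smul]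
      norm_num
    refine ⟨?_, _, ?_, h5⟩
    · have h6 : (B ^ (m + 1)) (a (k + (m + 1)) l) =
          c⁻¹ • B ((A ^ (2 * m)) (a (k + 1) l)) := by
        rw [h2, map_smul, smul_smul, inv_mul_cancel₀ hc, one_smul, pow_succ', Module.End.mul_apply,
          show k + (m + 1) = k + 1 + m by ring]
      have h7 : A (B ((A ^ (2 * m)) (a (k + 1) l))) = 0 := by
        rw [pow_succ', Module.End.mul_apply] at h1
        rw [← Module.End.mul_apply A B, hAB.eq, Module.End.mul_apply, h1, map_zero]
      rw [pow_succ', Module.End.mul_apply, h5, h6, map_smul, map_smul, h7, smul_zero, smul_zero]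
    · have : (0 : ℝ) < ((2 * m : ℕ) : ℝ) + 1 := by positivity
      positivity

theorem IsCommutantSystem.pow_left_eq_zero (h : IsCommutantSystem T A a)
    (hAT : A * T = T * A + B) (hAB : Commute A B) {n : ℕ} (hn : ∀ k l, n < k + l → a k l = 0)
    (k l : ℕ) : (A ^ (2 * n + 1)) (a k l) = 0 := by
  by_cases hkl : n < k + l
  · rw [hn k l hkl, map_zero]
  · obtain ⟨j, hj⟩ : ∃ j, 2 * n + 1 = j + (2 * (n - (k + l)) + 1) := ⟨2 * (k + l), by omega⟩
    rw [hj, pow_add, Module.End.mul_apply,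
      (h.pow_apply hAT hAB hn (n - (k + l)) k l (by omega)).1, map_zero]

/-- The equation for `a_{0,l}` has no `A` term, so the computation of `pow_apply` carried one step
further closes up to `0 = (2k+1) c B^(k+1) a_{kl}` with `c ≠ 0`. -/
theorem IsCommutantSystem.pow_right_top_eq_zero (h : IsCommutantSystem T A a)
    (hAT : A * T = T * A + B) (hAB : Commute A B) {n : ℕ} (hn : ∀ k l, n < k + l → a k l = 0)
    {k l : ℕ} (hkl : k + l = n) : (B ^ (k + 1)) (a k l) = 0 := by
  obtain ⟨h1, c, hc, h2⟩ := h.pow_apply hAT hAB hn k 0 l (by omega)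
  have h3 : (A ^ (2 * k + 1)) (lowerTerm a 0 l) = 0 := by
    rcases l with _ | l
    · simp [lowerTerm]
    · rw [lowerTerm, map_nsmul, (h.pow_apply hAT hAB hn k (0 + 1) l (by omega)).1, smul_zero]
  have h4 := LinearMap.congr_fun (pow_succ_mul_of_commutator hAT hAB (2 * k)) (a 0 l)
  simp only [Module.End.mul_apply, LinearMap.add_apply, LinearMap.smul_apply] at h4
  rw [h.zero, h3, h1, h2, map_zero, zero_add, map_smul, smul_smul, ← Module.End.mul_apply,
    ← pow_succ', zero_add] at h4
  have : (0 : ℝ) < ((2 * k : ℕ) : ℝ) + 1 := by positivity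
  exact (smul_eq_zero.1 h4.symm).resolve_left (by positivity)

/-- As `B` commutes with `T` and `A`, the family `B^(n+1) a` solves the same system. Its top-degree
members vanish, so its order is smaller and induction applies. -/
theorem IsCommutantSystem.exists_pow_right_eq_zero (hAT : A * T = T * A + B)
    (hAB : Commute A B) (hTB : Commute T B) (n : ℕ) :
    ∀ a : ℕ → ℕ → E, IsCommutantSystem T A a → (∀ k l, n ≤ k + l → a k l = 0) →
      ∃ N, ∀ k l, (B ^ N) (a k l) = 0 := by
  induction n with
  | zero => exact fun a _ hn => ⟨0, fun k l => by simp [hn k l]⟩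
  | succ n ih =>
    intro a h hn
    obtain ⟨N, hN⟩ := ih _ (h.map (hTB.pow_right (n + 1)) (hAB.pow_right (n + 1))) (by
      intro k l hkl
      rcases hkl.eq_or_lt with hkl | hkl
      · rw [show n + 1 = l + (k + 1) by omega, pow_add, Module.End.mul_apply,
          h.pow_right_top_eq_zero hAT hAB (n := n) (fun k l h => hn k l h) hkl.symm, map_zero]
      · rw [hn k l hkl, map_zero])
    exact ⟨N + (n + 1), fun k l => by rw [pow_add, Module.End.mul_apply, hN]⟩

end Nilpotency

/-! ### Locally nilpotent inner derivations with a slice -/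

section Slice

variable {R : Type*} [Ring R] [Algebra ℝ R]

/-- The inner derivation `Q ↦ p * Q - Q * p`. -/
def innerDer (p : R) : Module.End ℝ R := LinearMap.mulLeft ℝ p - LinearMap.mulRight ℝ p

theorem innerDer_apply (p Q : R) : innerDer p Q = p * Q - Q * p := rfl

theorem mul_pow_succ_of_commutator {p q : R} {r : ℝ} (h : p * q = q * p + algebraMap ℝ R r)
    (m : ℕ) : p * q ^ (m + 1) = q ^ (m + 1) * p + ((m + 1 : ℝ) * r) • q ^ m := by
  rw [Algebra.algebraMap_eq_smul_one] at h
  induction m with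
  | zero => simp [h]
  | succ m ih =>
    rw [pow_succ, ← mul_assoc, ih, add_mul, mul_assoc, h, mul_add, smul_mul_assoc, ← pow_succ,
      mul_smul_comm, mul_one, ← mul_assoc, ← pow_succ, add_assoc, ← add_smul]
    congr 2
    push_cast
    ring

theorem innerDer_pow_mul_pow {p q Q : R} {r : ℝ} (h : p * q = q * p + algebraMap ℝ R r)
    (hQ : Commute p Q) (m : ℕ) :
    (innerDer p ^ m) (Q * q ^ m) = (m.factorial * r ^ m : ℝ) • Q := by
  induction m with
  | zero => simp
  | succ m ih =>
    rw [pow_succ, Module.End.mul_apply, innerDer_apply, ← mul_assoc, hQ.eq, mul_assoc, mul_assoc,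
      mul_pow_succ_of_commutator h, mul_add, add_sub_cancel_left, mul_smul_comm, map_smul, ih,
      smul_smul, Nat.factorial_succ]
    congr 1
    push_cast
    ring

/-- If the inner derivation of `p` is locally nilpotent on a subalgebra `C` and `q ∈ C` satisfies
`[p, q] = r ≠ 0`, then `C` is generated by `q` and the elements of `C` commuting with `p`. -/
theorem le_of_slice {C S : Subalgebra ℝ R} {p q : R} {r : ℝ} (hr : r ≠ 0) (hp : p ∈ C)
    (hqC : q ∈ C) (hqS : q ∈ S) (h : p * q = q * p + algebraMap ℝ R r)
    (hker : ∀ Q ∈ C, Commute p Q → Q ∈ S) (hnil : ∀ Q ∈ C, ∃ m, (innerDer p ^ m) Q = 0) :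
    C ≤ S := by
  have hC : ∀ m, ∀ Q ∈ C, (innerDer p ^ m) Q ∈ C := by
    intro m
    induction m with
    | zero => exact fun Q hQ => hQ
    | succ m ih =>
      intro Q hQ
      rw [pow_succ, Module.End.mul_apply]
      exact ih _ (sub_mem (mul_mem hp hQ) (mul_mem hQ hp))
  have key : ∀ m, ∀ Q ∈ C, (innerDer p ^ m) Q = 0 → Q ∈ S := by
    intro m
    induction m with
    | zero => intro Q _ h0; rw [show Q = 0 from h0]; exact zero_mem S
    | succ m ih =>
      intro Q hQ h0
      rw [pow_succ', Module.End.mul_apply, innerDer_apply, sub_eq_zero] at h0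
      have hc : (m.factorial * r ^ m : ℝ) ≠ 0 :=
        mul_ne_zero (Nat.cast_ne_zero.2 m.factorial_ne_zero) (pow_ne_zero _ hr)
      have hS := hker _ (hC m Q hQ) h0
      -- Taylor expansion in `q`: removing the leading term, whose coefficient commutes with `p`,
      -- leaves an element killed by the `m`-th power of the derivation.
      have h1 := ih (Q - (m.factorial * r ^ m : ℝ)⁻¹ • ((innerDer p ^ m) Q * q ^ m))
        (sub_mem hQ (C.smul_mem (mul_mem (hC m Q hQ) (pow_mem hqC m)) _)) (by
          rw [map_sub, map_smul, innerDer_pow_mul_pow h h0, smul_smul, inv_mul_cancel₀ hc,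
            one_smul, sub_self])
      have h2 := add_mem h1 (S.smul_mem (mul_mem hS (pow_mem hqS m)) (m.factorial * r ^ m : ℝ)⁻¹)
      rwa [sub_add_cancel] at h2
  intro Q hQ
  obtain ⟨m, hm⟩ := hnil Q hQ
  exact key m Q hQ hm

end Slice

/-! ### Functions of the independent variables -/

theorem IsCoefficient.add {f g : diffFun} (hf : IsCoefficient f) (hg : IsCoefficient g) :
    IsCoefficient (f + g) := fun z w ht hx hy =>
  congrArg₂ (· + ·) (hf z w ht hx hy) (hg z w ht hx hy)

theorem IsCoefficient.mul {f g : diffFun} (hf : IsCoefficient f) (hg : IsCoefficient g) :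
    IsCoefficient (f * g) := fun z w ht hx hy =>
  congrArg₂ (· * ·) (hf z w ht hx hy) (hg z w ht hx hy)

theorem IsCoefficient.smul {f : diffFun} (hf : IsCoefficient f) (r : ℝ) :
    IsCoefficient (r • f) := fun z w ht hx hy => congrArg (r * ·) (hf z w ht hx hy)

theorem IsCoefficient.neg {f : diffFun} (hf : IsCoefficient f) : IsCoefficient (-f) :=
  fun z w ht hx hy => congrArg (- ·) (hf z w ht hx hy)

theorem isCoefficient_natCast (n : ℕ) : IsCoefficient (n : diffFun) := fun _ _ _ _ _ => rfl
theorem isCoefficient_zero : IsCoefficient 0 := fun _ _ _ _ _ => rfl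
theorem isCoefficient_one : IsCoefficient 1 := fun _ _ _ _ _ => rfl
theorem isCoefficient_X_t : IsCoefficient (X .t) := fun _ _ h _ _ => h
theorem isCoefficient_X_x : IsCoefficient (X .x) := fun _ _ _ h _ => h
theorem isCoefficient_X_y : IsCoefficient (X .y) := fun _ _ _ _ h => h

theorem partialDeriv_eq_of_update_eq {f : diffFun} {c : Coord} {z w : Jet} (hc : z c = w c)
    (h : ∀ s, f.1 (Function.update z c s) = f.1 (Function.update w c s)) :
    (partialDeriv c f).1 z = (partialDeriv c f).1 w := by
  rw [coe_partialDeriv, coe_partialDeriv, pd, pd, hc]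
  exact congrArg (fun g => deriv g (w c)) (funext h)

theorem IsCoefficient.update_eq {f : diffFun} (hf : IsCoefficient f) {z w : Jet}
    (ht : z .t = w .t) (hx : z .x = w .x) (hy : z .y = w .y) (c : Coord) (s : ℝ) :
    f.1 (Function.update z c s) = f.1 (Function.update w c s) := by
  apply hf <;> simp only [Function.update_apply, ht, hx, hy]

theorem IsCoefficient.partialDeriv_t {f : diffFun} (hf : IsCoefficient f) :
    IsCoefficient (partialDeriv .t f) := fun _ _ ht hx hy =>
  partialDeriv_eq_of_update_eq ht (hf.update_eq ht hx hy _)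

theorem IsCoefficient.partialDeriv_x {f : diffFun} (hf : IsCoefficient f) :
    IsCoefficient (partialDeriv .x f) := fun _ _ ht hx hy =>
  partialDeriv_eq_of_update_eq hx (hf.update_eq ht hx hy _)

theorem IsCoefficient.partialDeriv_y {f : diffFun} (hf : IsCoefficient f) :
    IsCoefficient (partialDeriv .y f) := fun _ _ ht hx hy =>
  partialDeriv_eq_of_update_eq hy (hf.update_eq ht hx hy _)

theorem IsCoefficient.partialDeriv_u {f : diffFun} (hf : IsCoefficient f) (k l : ℕ) :
    partialDeriv (.u k l) f = 0 := by
  ext z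
  rw [coe_partialDeriv, pd]
  have h : (fun s => f.1 (Function.update z (.u k l) s)) = fun _ => f.1 z :=
    funext fun s => hf _ _ (by simp) (by simp) (by simp)
  rw [h, deriv_const]
  rfl

/-- On functions of the independent variables, a vector field with constant components along one
of these variables acts as the partial derivative. -/
theorem IsCoefficient.vectorField_eq {f : diffFun} (hf : IsCoefficient f) {V : Coord → diffFun}
    {c : Coord} (hc : V c = 1) (h : ∀ d, d ≠ c → (∀ i j, d ≠ .u i j) → V d = 0) :
    vectorField V f = partialDeriv c f := by
  ext z
  rw [coe_partialDeriv, coe_vectorField, finsum_eq_single _ c]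
  · rw [hc]; exact one_mul _
  · intro d hd
    by_cases hu : ∃ i j, d = .u i j
    · obtain ⟨i, j, rfl⟩ := hu
      rw [← coe_partialDeriv, hf.partialDeriv_u]
      exact mul_zero _
    · rw [h d hd (by simpa using hu)]
      exact zero_mul _

theorem IsCoefficient.Dx_eq {f : diffFun} (hf : IsCoefficient f) : Dx f = partialDeriv .x f := by
  rw [Kolmogorov.Dx_eq]
  refine hf.vectorField_eq rfl fun d hd hu => ?_
  cases d <;> simp_all [xField]

theorem IsCoefficient.Dy_eq {f : diffFun} (hf : IsCoefficient f) : Dy f = partialDeriv .y f := by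
  rw [Kolmogorov.Dy_eq]
  refine hf.vectorField_eq rfl fun d hd hu => ?_
  cases d <;> simp_all [yField]

theorem IsCoefficient.Dt_eq {f : diffFun} (hf : IsCoefficient f) : Dt f = partialDeriv .t f := by
  rw [Kolmogorov.Dt_eq]
  refine hf.vectorField_eq rfl fun d hd hu => ?_
  cases d <;> simp_all [tField]

theorem IsCoefficient.Dx {f : diffFun} (hf : IsCoefficient f) : IsCoefficient (Dx f) :=
  hf.Dx_eq ▸ hf.partialDeriv_x

theorem IsCoefficient.Dy {f : diffFun} (hf : IsCoefficient f) : IsCoefficient (Dy f) :=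
  hf.Dy_eq ▸ hf.partialDeriv_y

theorem IsCoefficient.Dt {f : diffFun} (hf : IsCoefficient f) : IsCoefficient (Dt f) :=
  hf.Dt_eq ▸ hf.partialDeriv_t

theorem eq_update_of_partialDeriv_eq_zero {f : diffFun} {c : Coord} (h : partialDeriv c f = 0)
    (z : Jet) (s : ℝ) : f.1 z = f.1 (Function.update z c s) := by
  have hd : Differentiable ℝ fun s => f.1 (Function.update z c s) :=
    fun s => IsDiffFun.differentiableAt_update f.2 z c s
  have h0 : ∀ s, deriv (fun s => f.1 (Function.update z c s)) s = 0 := by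
    intro s
    have h1 := coe_partialDeriv c f (Function.update z c s)
    rw [h, pd, Function.update_self] at h1
    simp only [Function.update_idem] at h1
    exact h1.symm
  have h2 := is_const_of_deriv_eq_zero hd h0 (z c) s
  simpa using h2

/-! ### Normal forms of operators in `Dx` and `Dy` -/

/-- The linear differential operator `∑ a (k, l) D_x^k D_y^l`. -/
noncomputable def op : (ℕ × ℕ →₀ diffFun) →ₗ[ℝ] Module.End ℝ diffFun :=
  Finsupp.lsum ℝ fun p => LinearMap.mulRight ℝ (Dx ^ p.1 * Dy ^ p.2) ∘ₗ LinearMap.mul ℝ diffFun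

theorem op_single (p : ℕ × ℕ) (f : diffFun) :
    op (Finsupp.single p f) = M f * (Dx ^ p.1 * Dy ^ p.2) := by
  rw [op, Finsupp.lsum_single]; rfl

theorem op_apply (a : ℕ × ℕ →₀ diffFun) (f : diffFun) :
    op a f = a.sum fun p g => g * (Dx ^ p.1) ((Dy ^ p.2) f) := by
  rw [op, Finsupp.lsum_apply, Finsupp.sum, LinearMap.sum_apply]; rfl

theorem Dx_pow_Dy_pow_X_u (k l : ℕ) : (Dx ^ k) ((Dy ^ l) (X (.u 0 0))) = X (.u k l) := by
  have h : (Dy ^ l) (X (.u 0 0)) = X (.u 0 l) := by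
    induction l with
    | zero => rfl
    | succ l ih => rw [pow_succ', Module.End.mul_apply, ih, Dy_X_u]
  rw [h]
  induction k with
  | zero => rfl
  | succ k ih => rw [pow_succ', Module.End.mul_apply, ih, Dx_X_u]

theorem op_apply_u (a : ℕ × ℕ →₀ diffFun) :
    op a (X (.u 0 0)) = a.sum fun p g => g * X (.u p.1 p.2) := by
  simp only [op_apply, Dx_pow_Dy_pow_X_u]

/-- The value on `u` is linear in the jet variables, so the coefficients can be read off from it;
this gives uniqueness of the normal form. -/
theorem partialDeriv_op_apply_u {a : ℕ × ℕ →₀ diffFun} (ha : ∀ p, IsCoefficient (a p))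
    (k l : ℕ) : partialDeriv (.u k l) (op a (X (.u 0 0))) = a (k, l) := by
  rw [op_apply_u, Finsupp.sum, map_sum, Finset.sum_eq_single (k, l)]
  · rw [partialDeriv_mul, (ha _).partialDeriv_u, zero_mul, zero_add, partialDeriv_X,
      Pi.single_eq_same, mul_one]
  · rintro ⟨i, j⟩ - hp
    rw [partialDeriv_mul, (ha _).partialDeriv_u, zero_mul, zero_add, partialDeriv_X,
      Pi.single_eq_of_ne (fun h => hp (by cases h; rfl)), mul_zero]
  · intro h
    rw [Finsupp.notMem_support_iff.1 h, zero_mul, map_zero]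

theorem eq_zero_of_op_apply_u {a : ℕ × ℕ →₀ diffFun} (ha : ∀ p, IsCoefficient (a p))
    (h : op a (X (.u 0 0)) = 0) : a = 0 := by
  ext1 p
  rw [← partialDeriv_op_apply_u ha, h, map_zero]
  rfl

theorem M_mul_M (f g : diffFun) : M f * M g = M (f * g) :=
  LinearMap.ext fun h => (mul_assoc f g h).symm

theorem Dx_mul_M (f : diffFun) : Dx * M f = M (Dx f) + M f * Dx := LinearMap.ext (Dx_mul f)
theorem Dy_mul_M (f : diffFun) : Dy * M f = M (Dy f) + M f * Dy := LinearMap.ext (Dy_mul f)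
theorem Dt_mul_M (f : diffFun) : Dt * M f = M (Dt f) + M f * Dt := LinearMap.ext (Dt_mul f)

theorem commute_Dx_Dy : Commute Dx Dy := LinearMap.ext Dx_Dy
theorem commute_Dt_Dx : Commute Dt Dx := LinearMap.ext Dt_Dx
theorem commute_Dt_Dy : Commute Dt Dy := LinearMap.ext Dt_Dy

/-- The operators `∑ a (k, l) D_x^k D_y^l` with coefficients depending on `t`, `x`, `y` only. -/
noncomputable def normalForms : Submodule ℝ (Module.End ℝ diffFun) where
  carrier := {Q | ∃ a, (∀ p, IsCoefficient (a p)) ∧ op a = Q}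
  zero_mem' := ⟨0, fun _ => isCoefficient_zero, map_zero op⟩
  add_mem' := by
    rintro _ _ ⟨a, ha, rfl⟩ ⟨b, hb, rfl⟩
    exact ⟨a + b, fun p => (ha p).add (hb p), map_add op a b⟩
  smul_mem' := by
    rintro r _ ⟨a, ha, rfl⟩
    exact ⟨r • a, fun p => (ha p).smul r, map_smul op r a⟩

theorem single_mem_normalForms {f : diffFun} (hf : IsCoefficient f) (k l : ℕ) :
    M f * (Dx ^ k * Dy ^ l) ∈ normalForms := by
  refine ⟨Finsupp.single (k, l) f, fun p => ?_, op_single _ _⟩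
  rw [Finsupp.single_apply]
  split_ifs
  · exact hf
  · exact isCoefficient_zero

theorem mul_mem_normalForms {P : Module.End ℝ diffFun}
    (h : ∀ f, IsCoefficient f → ∀ k l, P * (M f * (Dx ^ k * Dy ^ l)) ∈ normalForms)
    {Q : Module.End ℝ diffFun} (hQ : Q ∈ normalForms) : P * Q ∈ normalForms := by
  obtain ⟨a, ha, rfl⟩ := hQ
  rw [← Finsupp.sum_single a, Finsupp.sum, map_sum, Finset.mul_sum]
  refine sum_mem fun p _ => ?_
  rw [op_single]
  exact h _ (ha p) _ _

theorem diffOps_le_normalForms {Q : Module.End ℝ diffFun} (hQ : Q ∈ diffOps) :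
    Q ∈ normalForms := by
  -- Stability under left multiplication need only be checked for generators, which avoids
  -- reordering a product of two general normal forms.
  suffices h : ∀ N ∈ normalForms, Q * N ∈ normalForms by
    have h1 : (1 : Module.End ℝ diffFun) ∈ normalForms := by
      have := single_mem_normalForms isCoefficient_one 0 0
      rwa [pow_zero, pow_zero, mul_one, mul_one,
        show M 1 = 1 from LinearMap.ext fun f => one_mul f] at this
    simpa using h 1 h1
  induction hQ using Algebra.adjoin_induction with
  | mem P hP =>
    intro N hN
    refine mul_mem_normalForms (fun f hf k l => ?_) hN
    rcases hP with ⟨g, hg, rfl⟩ | rfl | rfl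
    · rw [← mul_assoc, M_mul_M]
      exact single_mem_normalForms (hg.mul hf) k l
    · rw [← mul_assoc, Dx_mul_M, add_mul, mul_assoc, ← mul_assoc Dx, ← pow_succ']
      exact add_mem (single_mem_normalForms hf.Dx k l) (single_mem_normalForms hf (k + 1) l)
    · rw [← mul_assoc, Dy_mul_M, add_mul, mul_assoc, ← mul_assoc Dy,
        (commute_Dx_Dy.symm.pow_right k).eq, mul_assoc, ← pow_succ']
      exact add_mem (single_mem_normalForms hf.Dy k l) (single_mem_normalForms hf k (l + 1))
  | algebraMap r =>
    intro N hN
    rw [← Algebra.smul_def]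
    exact normalForms.smul_mem r hN
  | add P Q _ _ hP hQ =>
    intro N hN
    rw [add_mul]
    exact add_mem (hP N hN) (hQ N hN)
  | mul P Q _ _ hP hQ =>
    intro N hN
    rw [mul_assoc]
    exact hP _ (hQ N hN)

/-- An operator in `D_x`, `D_y` is determined by its action on `u`. -/
theorem eq_zero_of_apply_u {Q : Module.End ℝ diffFun} (hQ : Q ∈ diffOps)
    (h : Q (X (.u 0 0)) = 0) : Q = 0 := by
  obtain ⟨a, ha, rfl⟩ := diffOps_le_normalForms hQ
  rw [eq_zero_of_op_apply_u ha h, map_zero]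

/-- Such a `D` sees only the coefficients. It is used with `D = Dy` and `D = P1`, turning nilpotency
on coefficients into nilpotency of `ad D`. -/
theorem op_commutator {D : Module.End ℝ diffFun}
    (hD : ∀ f, D * M f = M (D f) + M f * D) (hx : Commute D Dx) (hy : Commute D Dy)
    (a : ℕ × ℕ →₀ diffFun) :
    innerDer D (op a) = op (Finsupp.mapRange.linearMap D a) := by
  induction a using Finsupp.induction_linear with
  | zero => simp
  | add a b ha hb => simp only [map_add, ha, hb]
  | single p f =>
    rw [Finsupp.mapRange.linearMap_apply, Finsupp.mapRange_single, op_single, op_single,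
      innerDer_apply, ← mul_assoc, hD, add_mul, mul_assoc (M f) D,
      ((hx.pow_right p.1).mul_right (hy.pow_right p.2)).eq, ← mul_assoc (M f)]
    exact add_sub_cancel_right (G := Module.End ℝ diffFun) _ _

theorem op_commutator_pow {D : Module.End ℝ diffFun}
    (hD : ∀ f, D * M f = M (D f) + M f * D) (hx : Commute D Dx) (hy : Commute D Dy)
    (m : ℕ) (a : ℕ × ℕ →₀ diffFun) :
    (innerDer D ^ m) (op a) = op (Finsupp.mapRange.linearMap (D ^ m) a) := by
  induction m with
  | zero =>
    refine congrArg op (Finsupp.ext fun p => ?_)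
    simp
  | succ m ih =>
    rw [pow_succ', Module.End.mul_apply, ih, op_commutator hD hx hy]
    refine congrArg op (Finsupp.ext fun p => ?_)
    simp [pow_succ']

/-! ### From recursion operators to the commutant of `F` -/

theorem M_mem_diffOps {f : diffFun} (hf : IsCoefficient f) : M f ∈ diffOps :=
  Algebra.subset_adjoin (Or.inl ⟨f, hf, rfl⟩)

theorem Dx_mem_diffOps : Dx ∈ diffOps := Algebra.subset_adjoin (Or.inr (Or.inl rfl))

theorem Dy_mem_diffOps : Dy ∈ diffOps := Algebra.subset_adjoin (Or.inr (Or.inr rfl))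

theorem P1_mem_diffOps : P1 ∈ diffOps :=
  add_mem Dx_mem_diffOps (mul_mem (M_mem_diffOps isCoefficient_X_t) Dy_mem_diffOps)

theorem IsCoefficient.pow {f : diffFun} (hf : IsCoefficient f) (n : ℕ) :
    IsCoefficient (f ^ n) := fun z w ht hx hy => congrArg (· ^ n) (hf z w ht hx hy)

theorem P2_mem_diffOps : P2 ∈ diffOps :=
  add_mem (add_mem
    (mul_mem (M_mem_diffOps ((isCoefficient_natCast 2).mul isCoefficient_X_t)) Dx_mem_diffOps)
    (mul_mem (M_mem_diffOps (isCoefficient_X_t.pow 2)) Dy_mem_diffOps))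
    (M_mem_diffOps isCoefficient_X_x)

theorem P3_mem_diffOps : P3 ∈ diffOps :=
  sub_mem (add_mem
    (mul_mem (M_mem_diffOps ((isCoefficient_natCast 3).mul (isCoefficient_X_t.pow 2)))
      Dx_mem_diffOps)
    (mul_mem (M_mem_diffOps (isCoefficient_X_t.pow 3)) Dy_mem_diffOps))
    (M_mem_diffOps ((isCoefficient_natCast 3).mul (by
      rw [sub_eq_add_neg]
      exact isCoefficient_X_y.add (isCoefficient_X_t.mul isCoefficient_X_x).neg)))

/-- The bracket with `Dt` is a derivation that differentiates coefficients and kills `Dx` and `Dy`,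
so no `Dt` survives in it. -/
theorem innerDer_Dt_mem_diffOps {Q : Module.End ℝ diffFun} (hQ : Q ∈ diffOps) :
    innerDer Dt Q ∈ diffOps := by
  induction hQ using Algebra.adjoin_induction with
  | mem P hP =>
    rcases hP with ⟨g, hg, rfl⟩ | rfl | rfl
    · rw [innerDer_apply, Dt_mul_M]
      convert M_mem_diffOps hg.Dt using 1
      exact add_sub_cancel_right (G := Module.End ℝ diffFun) _ _
    · rw [innerDer_apply, commute_Dt_Dx.eq, sub_self]
      exact zero_mem _
    · rw [innerDer_apply, commute_Dt_Dy.eq, sub_self]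
      exact zero_mem _
  | algebraMap r =>
    rw [innerDer_apply, Algebra.commutes, sub_self]
    exact zero_mem _
  | add P Q _ _ hP hQ =>
    rw [map_add]
    exact add_mem hP hQ
  | mul P Q hP' hQ' hP hQ =>
    have h : innerDer Dt (P * Q) = innerDer Dt P * Q + P * innerDer Dt Q := by
      simp only [innerDer_apply]
      noncomm_ring
    rw [h]
    exact add_mem (mul_mem hP hQ') (mul_mem hP' hQ)

/-- The restriction of `-D_t` to solutions, as an operator in `D_x` and `D_y`. -/
theorem spatial_mem_diffOps : M (X .x) * Dy - Dx ^ 2 ∈ diffOps :=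
  sub_mem (mul_mem (M_mem_diffOps isCoefficient_X_x) Dy_mem_diffOps) (pow_mem Dx_mem_diffOps 2)

theorem X_u_mem_genSym : X (.u 0 0) ∈ genSym := by
  change F (X (.u 0 0)) = 0
  rw [F_apply, Dt_X_u, Dy_X_u, Dx_X_u, Dx_X_u]
  simp

/-- The commutator lies in `diffOps` and vanishes on `u`, since `u` and `Q u` are both symmetries.
-/
theorem commute_F_of_mem_Upsilon {Q : Module.End ℝ diffFun} (hQ : Q ∈ Upsilon) :
    Commute F Q := by
  have h : F * Q - Q * F = innerDer Dt Q +
      ((M (X .x) * Dy - Dx ^ 2) * Q - Q * (M (X .x) * Dy - Dx ^ 2)) := by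
    rw [F, innerDer_apply]
    noncomm_ring
  refine sub_eq_zero.1 (eq_zero_of_apply_u ?_ ?_)
  · rw [h]
    exact add_mem (innerDer_Dt_mem_diffOps hQ.1)
      (sub_mem (mul_mem spatial_mem_diffOps hQ.1) (mul_mem hQ.1 spatial_mem_diffOps))
  · have h1 : F (X (.u 0 0)) = 0 := X_u_mem_genSym
    have h2 : F (Q (X (.u 0 0))) = 0 := hQ.2 _ X_u_mem_genSym
    rw [LinearMap.sub_apply, Module.End.mul_apply, Module.End.mul_apply, h1, h2, map_zero,
      sub_zero]

/-- The operators in `D_x`, `D_y` that commute with `F`. -/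
noncomputable def commutant : Subalgebra ℝ (Module.End ℝ diffFun) :=
  diffOps ⊓ Subalgebra.centralizer ℝ {F}

theorem mem_commutant {Q : Module.End ℝ diffFun} :
    Q ∈ commutant ↔ Q ∈ diffOps ∧ Commute F Q := by
  rw [commutant, Algebra.mem_inf, Subalgebra.mem_centralizer_iff]
  simp [Commute, SemiconjBy]

theorem P0_mem_commutant : P0 ∈ commutant := mem_commutant.2 ⟨Dy_mem_diffOps, commute_F_P0⟩
theorem P1_mem_commutant : P1 ∈ commutant := mem_commutant.2 ⟨P1_mem_diffOps, commute_F_P1⟩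
theorem P2_mem_commutant : P2 ∈ commutant := mem_commutant.2 ⟨P2_mem_diffOps, commute_F_P2⟩
theorem P3_mem_commutant : P3 ∈ commutant := mem_commutant.2 ⟨P3_mem_diffOps, commute_F_P3⟩

theorem UpsilonR_le_commutant : UpsilonR ≤ commutant := by
  refine Algebra.adjoin_le ?_
  rintro _ (rfl | rfl | rfl | rfl)
  exacts [P0_mem_commutant, P1_mem_commutant, P2_mem_commutant, P3_mem_commutant]

theorem P0_mem_UpsilonR : P0 ∈ UpsilonR := Algebra.subset_adjoin (by simp)
theorem P1_mem_UpsilonR : P1 ∈ UpsilonR := Algebra.subset_adjoin (by simp)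
theorem P2_mem_UpsilonR : P2 ∈ UpsilonR := Algebra.subset_adjoin (by simp)
theorem P3_mem_UpsilonR : P3 ∈ UpsilonR := Algebra.subset_adjoin (by simp)

theorem commutant_le_Upsilon : commutant ≤ Upsilon := by
  intro Q hQ
  obtain ⟨h1, h2⟩ := mem_commutant.1 hQ
  refine ⟨h1, fun η hη => ?_⟩
  change F η = 0 at hη
  change F (Q η) = 0
  rw [← Module.End.mul_apply, h2.eq, Module.End.mul_apply, hη, map_zero]

/-! ### The coefficient system and local nilpotency -/

/-- The system is `F (Q u) = 0` differentiated in each jet variable. -/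
theorem isCommutantSystem_of_commute {a : ℕ × ℕ →₀ diffFun} (ha : ∀ p, IsCoefficient (a p))
    (h : Commute F (op a)) : IsCommutantSystem F Dx fun k l => a (k, l) := by
  have h0 : F (op a (X (.u 0 0))) = 0 := by
    rw [← Module.End.mul_apply, h.eq, Module.End.mul_apply,
      show F (X (.u 0 0)) = 0 from X_u_mem_genSym, map_zero]
  constructor
  · intro l
    have h1 := partialDeriv_u_zero_F l (op a (X (.u 0 0)))
    simp only [h0, map_zero, partialDeriv_op_apply_u ha] at h1
    exact (sub_eq_zero.1 h1.symm)
  · intro k l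
    have h1 := partialDeriv_u_succ_F k l (op a (X (.u 0 0)))
    simp only [h0, map_zero, partialDeriv_op_apply_u ha] at h1
    rw [ofNat_smul_eq_nsmul ℝ]
    rw [sub_sub] at h1
    exact (sub_eq_zero.1 h1.symm)

theorem exists_order (a : ℕ × ℕ →₀ diffFun) : ∃ n, ∀ k l, n ≤ k + l → a (k, l) = 0 := by
  refine ⟨a.support.sup (fun p => p.1 + p.2) + 1, fun k l hkl => ?_⟩
  by_contra h
  have := Finset.le_sup (f := fun p : ℕ × ℕ => p.1 + p.2) (Finsupp.mem_support_iff.2 h)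
  simp only at this
  omega

theorem Dx_mul_F : Dx * F = F * Dx + Dy := LinearMap.ext fun f => by
  change Dx (F f) = F (Dx f) + Dy f
  simp only [F_apply, map_add, map_sub, Dx_mul, Dx_X_x, Dt_Dx, Dx_Dy]
  ring

theorem exists_Dy_pow_eq_zero {a : ℕ × ℕ →₀ diffFun} (ha : ∀ p, IsCoefficient (a p))
    (h : Commute F (op a)) : ∃ N, ∀ p, (Dy ^ N) (a p) = 0 := by
  obtain ⟨n, hn⟩ := exists_order a
  obtain ⟨N, hN⟩ := IsCommutantSystem.exists_pow_right_eq_zero Dx_mul_F commute_Dx_Dy commute_F_P0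
    n _ (isCommutantSystem_of_commute ha h) hn
  exact ⟨N, fun p => hN p.1 p.2⟩

theorem exists_Dx_pow_eq_zero {a : ℕ × ℕ →₀ diffFun} (ha : ∀ p, IsCoefficient (a p))
    (h : Commute F (op a)) : ∃ N, ∀ p, (Dx ^ N) (a p) = 0 := by
  obtain ⟨n, hn⟩ := exists_order a
  exact ⟨2 * n + 1, fun p => (isCommutantSystem_of_commute ha h).pow_left_eq_zero Dx_mul_F
    commute_Dx_Dy (fun k l hkl => hn k l hkl.le) p.1 p.2⟩

theorem P1_mul_M (f : diffFun) : P1 * M f = M (P1 f) + M f * P1 := LinearMap.ext fun g => by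
  change P1 (f * g) = P1 f * g + f * P1 g
  simp only [P1_apply, Dx_mul, Dy_mul]
  ring

theorem commute_P1_Dx : Commute P1 Dx := LinearMap.ext fun f => by
  change P1 (Dx f) = Dx (P1 f)
  simp only [P1_apply, map_add, Dx_mul, Dx_X_t, Dx_Dy]
  ring

/-! ### Operators commuting with `P0` and `P1` -/

theorem Dy_apply_eq_zero_of_commute {a : ℕ × ℕ →₀ diffFun} (ha : ∀ p, IsCoefficient (a p))
    (h : Commute P0 (op a)) (p : ℕ × ℕ) : Dy (a p) = 0 := by
  have h1 : op (Finsupp.mapRange.linearMap Dy a) = 0 := by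
    rw [← op_commutator Dy_mul_M commute_Dx_Dy.symm (Commute.refl Dy), innerDer_apply]
    exact sub_eq_zero.2 h.eq
  have h2 := eq_zero_of_op_apply_u (a := Finsupp.mapRange.linearMap Dy a)
    (fun p => by simpa using (ha p).Dy)
    (by rw [h1, LinearMap.zero_apply])
  simpa using DFunLike.congr_fun h2 p

theorem Dx_apply_eq_zero_of_commute {a : ℕ × ℕ →₀ diffFun} (ha : ∀ p, IsCoefficient (a p))
    (h0 : Commute P0 (op a)) (h : Commute P1 (op a)) (p : ℕ × ℕ) : Dx (a p) = 0 := by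
  have hD : ∀ p, P1 (a p) = Dx (a p) := fun p => by
    rw [P1_apply, Dy_apply_eq_zero_of_commute ha h0, mul_zero, add_zero]
  have h1 : op (Finsupp.mapRange.linearMap P1 a) = 0 := by
    rw [← op_commutator P1_mul_M commute_P1_Dx commute_P0_P1.symm, innerDer_apply]
    exact sub_eq_zero.2 h.eq
  have h2 := eq_zero_of_op_apply_u (a := Finsupp.mapRange.linearMap P1 a) (fun p => by
    rw [Finsupp.mapRange.linearMap_apply, Finsupp.mapRange_apply, hD]
    exact (ha p).Dx) (by rw [h1, LinearMap.zero_apply])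
  rw [← hD]
  simpa using DFunLike.congr_fun h2 p

/-- Modulo left multiples of `t`, `P1` is `Dx`; the congruence survives powers because `P1` commutes
with multiplication by `t`. -/
theorem exists_P1_pow_eq (k : ℕ) : ∃ S, P1 ^ k = Dx ^ k + M (X .t) * S := by
  have hP : P1 * M (X .t) = M (X .t) * P1 := LinearMap.ext fun g => by
    change P1 (X .t * g) = X .t * P1 g
    simp only [P1_apply, Dx_mul, Dy_mul, Dx_X_t, Dy_X_t]
    ring
  induction k with
  | zero => exact ⟨0, by simp⟩
  | succ k ih =>
    obtain ⟨S, hS⟩ := ih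
    refine ⟨Dy * Dx ^ k + P1 * S, ?_⟩
    rw [pow_succ', hS, mul_add, ← mul_assoc, hP, P1, pow_succ']
    noncomm_ring

theorem P1_pow_apply_of_t_eq_zero (k : ℕ) (f : diffFun) {z : Jet} (hz : z .t = 0) :
    ((P1 ^ k) f).1 z = ((Dx ^ k) f).1 z := by
  obtain ⟨S, hS⟩ := exists_P1_pow_eq k
  rw [hS]
  change ((Dx ^ k) f).1 z + z .t * (S f).1 z = _
  rw [hz, zero_mul, add_zero]

/-- An operator commuting with `F`, `P⁰` and `P¹` vanishes if it vanishes on `u` at `t = 0`. -/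
theorem eq_zero_of_vanishing_initial {Q : Module.End ℝ diffFun} (hQ : Q ∈ commutant)
    (h0 : Commute P0 Q) (h1 : Commute P1 Q)
    (hz : ∀ z : Jet, z .t = 0 → (Q (X (.u 0 0))).1 z = 0) : Q = 0 := by
  obtain ⟨hQ1, hF⟩ := mem_commutant.1 hQ
  obtain ⟨a, ha, rfl⟩ := diffOps_le_normalForms hQ1
  have hy := Dy_apply_eq_zero_of_commute ha h0
  have hx := Dx_apply_eq_zero_of_commute ha h0 h1
  have hsys := isCommutantSystem_of_commute ha hF
  have hFa : ∀ p, F (a p) = Dt (a p) := fun p => by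
    rw [F_apply, hy, hx, map_zero, mul_zero, add_zero, sub_zero]
  -- With `x`- and `y`-independent coefficients the system is an ODE in `t`, triangular in `l`: the
  -- right side involves only index `l - 1`.
  have ht : ∀ k l, Dt (a (k, l)) = lowerTerm (fun k l => a (k, l)) k l := by
    rintro (_ | k) l
    · rw [← hFa]; exact hsys.zero l
    · rw [← hFa]
      refine (hsys.succ k l).trans ?_
      rw [hx, smul_zero, zero_add]
  have hinit : ∀ p (z : Jet), z .t = 0 → (a p).1 z = 0 := by
    rintro ⟨k, l⟩ z h
    rw [← partialDeriv_op_apply_u ha, coe_partialDeriv, pd]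
    -- Varying a jet variable stays inside `t = 0`, so the vanishing passes to the coefficient.
    have : (fun s => (op a (X (.u 0 0))).1 (Function.update z (.u k l) s)) = fun _ => 0 :=
      funext fun s => hz _ (by simpa using h)
    rw [this, deriv_const]
  have hzero : ∀ p, Dt (a p) = 0 → a p = 0 := by
    intro p hp
    rw [(ha p).Dt_eq] at hp
    ext z
    rw [eq_update_of_partialDeriv_eq_zero hp z 0]
    exact hinit p _ (by simp)
  have hall : ∀ l k, a (k, l) = 0 := by
    intro l
    induction l with
    | zero => exact fun k => hzero _ (ht k 0)
    | succ l ih =>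
      intro k
      refine hzero _ ?_
      rw [ht, lowerTerm, ih, smul_zero]
  rw [show a = 0 from Finsupp.ext fun p => hall p.2 p.1, map_zero]

theorem mem_UpsilonR_of_commute {Q : Module.End ℝ diffFun} (hQ : Q ∈ commutant)
    (h0 : Commute P0 Q) (h1 : Commute P1 Q) : Q ∈ UpsilonR := by
  obtain ⟨a, ha, hQa⟩ := diffOps_le_normalForms (mem_commutant.1 hQ).1
  have hy := Dy_apply_eq_zero_of_commute ha (hQa ▸ h0)
  have hx := Dx_apply_eq_zero_of_commute ha (hQa ▸ h0) (hQa ▸ h1)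
  have hconst : ∀ p (z : Jet), z .t = 0 → (a p).1 z = (a p).1 0 := by
    intro p z hz
    have hx' := hx p
    have hy' := hy p
    rw [(ha p).Dx_eq] at hx'
    rw [(ha p).Dy_eq] at hy'
    rw [eq_update_of_partialDeriv_eq_zero hx' z 0, eq_update_of_partialDeriv_eq_zero hy' _ 0]
    exact ha p _ _ (by simpa using hz) (by simp) (by simp)
  -- Freezing the coefficients at the origin gives an element of `UpsilonR` with the same initial
  -- data at `t = 0`.
  set R : Module.End ℝ diffFun := ∑ p ∈ a.support, (a p).1 0 • (P1 ^ p.1 * P0 ^ p.2) with hRdef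
  have hR : R ∈ UpsilonR := sum_mem fun p _ => UpsilonR.smul_mem
    (mul_mem (pow_mem P1_mem_UpsilonR _) (pow_mem P0_mem_UpsilonR _)) _
  have hR0 : Commute P0 R := Commute.sum_right _ _ _ fun p _ => Commute.smul_right
    ((commute_P0_P1.pow_right _).mul_right ((Commute.refl P0).pow_right _)) _
  have hR1 : Commute P1 R := Commute.sum_right _ _ _ fun p _ => Commute.smul_right
    (((Commute.refl P1).pow_right _).mul_right (commute_P0_P1.symm.pow_right _)) _
  have hzero : Q - R = 0 := by
    refine eq_zero_of_vanishing_initial (sub_mem hQ (UpsilonR_le_commutant hR))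
      (h0.sub_right hR0) (h1.sub_right hR1) fun z hz => ?_
    rw [LinearMap.sub_apply, ← hQa, op_apply, hRdef, LinearMap.sum_apply, Finsupp.sum,
      ← Finset.sum_sub_distrib, AddSubmonoidClass.coe_finsetSum, Finset.sum_apply]
    refine Finset.sum_eq_zero fun p _ => ?_
    change (a p).1 z * ((Dx ^ p.1) ((Dy ^ p.2) (X (.u 0 0)))).1 z -
      (a p).1 0 * ((P1 ^ p.1) ((Dy ^ p.2) (X (.u 0 0)))).1 z = 0
    rw [hconst p z hz, P1_pow_apply_of_t_eq_zero _ _ hz, sub_self]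
  rw [sub_eq_zero.1 hzero]
  exact hR

/-! ### The commutant is generated by `P0`, `P1`, `P2`, `P3` -/

theorem commutant_le_UpsilonR : commutant ≤ UpsilonR := by
  have h3 : P0 * P3 = P3 * P0 + algebraMap ℝ _ (-3) := by
    rw [P0_mul_P3, sub_eq_add_neg, map_neg, map_ofNat]
  have h2 : P1 * P2 = P2 * P1 + algebraMap ℝ _ 1 := by rw [P1_mul_P2, map_one]
  have hcent : ∀ {Q}, Q ∈ commutant ⊓ Subalgebra.centralizer ℝ {P0} ↔
      Q ∈ commutant ∧ Commute P0 Q := by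
    intro Q
    rw [Algebra.mem_inf, Subalgebra.mem_centralizer_iff]
    simp [Commute, SemiconjBy]
  have hker : commutant ⊓ Subalgebra.centralizer ℝ {P0} ≤ UpsilonR := by
    refine le_of_slice one_ne_zero (hcent.2 ⟨P1_mem_commutant, commute_P0_P1⟩)
      (hcent.2 ⟨P2_mem_commutant, commute_P0_P2⟩) P2_mem_UpsilonR h2
      (fun Q hQ h => mem_UpsilonR_of_commute (hcent.1 hQ).1 (hcent.1 hQ).2 h) fun Q hQ => ?_
    obtain ⟨hQC, hQ0⟩ := hcent.1 hQ
    obtain ⟨a, ha, rfl⟩ := diffOps_le_normalForms (mem_commutant.1 hQC).1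
    obtain ⟨N, hN⟩ := exists_Dx_pow_eq_zero ha (mem_commutant.1 hQC).2
    -- Coefficients of operators commuting with `P0` satisfy `Dy a = 0`, so on them `P1` acts as
    -- `Dx`.
    have hpow : ∀ m p, (P1 ^ m) (a p) = (Dx ^ m) (a p) := by
      intro m p
      induction m with
      | zero => rfl
      | succ m ih =>
        have h : Dy ((Dx ^ m) (a p)) = 0 := by
          rw [← Module.End.mul_apply, (commute_Dx_Dy.symm.pow_right m).eq, Module.End.mul_apply,
            Dy_apply_eq_zero_of_commute ha hQ0, map_zero]
        rw [pow_succ', Module.End.mul_apply, ih, P1_apply, h, mul_zero, add_zero, pow_succ',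
          Module.End.mul_apply]
    refine ⟨N, ?_⟩
    rw [op_commutator_pow P1_mul_M commute_P1_Dx commute_P0_P1.symm]
    rw [show Finsupp.mapRange.linearMap (P1 ^ N) a = 0 from Finsupp.ext fun p => by
      rw [Finsupp.mapRange.linearMap_apply, Finsupp.mapRange_apply, hpow, hN]; rfl, map_zero]
  refine le_of_slice (by norm_num) P0_mem_commutant P3_mem_commutant P3_mem_UpsilonR h3
    (fun Q hQ h => hker (hcent.2 ⟨hQ, h⟩)) fun Q hQ => ?_
  obtain ⟨a, ha, rfl⟩ := diffOps_le_normalForms (mem_commutant.1 hQ).1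
  obtain ⟨N, hN⟩ := exists_Dy_pow_eq_zero ha (mem_commutant.1 hQ).2
  refine ⟨N, ?_⟩
  rw [P0, op_commutator_pow Dy_mul_M commute_Dx_Dy.symm (Commute.refl Dy)]
  rw [show Finsupp.mapRange.linearMap (Dy ^ N) a = 0 from Finsupp.ext fun p => by
    rw [Finsupp.mapRange.linearMap_apply, Finsupp.mapRange_apply, hN]; rfl, map_zero]

theorem Upsilon_eq_UpsilonR : Upsilon = UpsilonR :=
  le_antisymm
    (fun _ hQ => commutant_le_UpsilonR (mem_commutant.2 ⟨hQ.1, commute_F_of_mem_Upsilon hQ⟩))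
    (UpsilonR_le_commutant.trans commutant_le_Upsilon)

/-! ### Eliminating `Dt` on symmetries -/

/-- On generalized symmetries, `D_t` can be eliminated by means of the equation. -/
theorem exists_diffOps_eq_on_genSym {Q : Module.End ℝ diffFun} (hQ : Q ∈ diffOpsT) :
    ∃ R ∈ diffOps, ∀ η ∈ genSym, Q η = R η := by
  -- In a product `Q₁ Q₂ η` the intermediate `Q₂ η` need not be a symmetry. Carrying a right factor
  -- `P` keeps the argument at `η`, where the equation holds.
  suffices h : ∀ P ∈ diffOps, ∃ R ∈ diffOps, ∀ η ∈ genSym, Q (P η) = R η from h 1 (one_mem _)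
  induction hQ using Algebra.adjoin_induction with
  | mem Q hQ =>
    intro P hP
    rcases hQ with ⟨g, hg, rfl⟩ | rfl | rfl | rfl
    · exact ⟨M g * P, mul_mem (M_mem_diffOps hg) hP, fun _ _ => rfl⟩
    -- Here `Dt P η = [Dt, P] η + P (Dt η)`, and `F η = 0` gives `Dt η = -(x Dy - Dx²) η`.
    · refine ⟨innerDer Dt P - P * (M (X .x) * Dy - Dx ^ 2),
        sub_mem (innerDer_Dt_mem_diffOps hP) (mul_mem hP spatial_mem_diffOps), fun η hη => ?_⟩
      have h1 : Dt η = -((M (X .x) * Dy - Dx ^ 2) η) := by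
        refine eq_neg_of_add_eq_zero_left ?_
        rw [← LinearMap.add_apply, ← add_sub_assoc]
        exact hη
      rw [innerDer_apply, LinearMap.sub_apply, LinearMap.sub_apply, Module.End.mul_apply,
        Module.End.mul_apply, Module.End.mul_apply, h1, map_neg, sub_neg_eq_add,
        add_sub_cancel_right]
    · exact ⟨Dx * P, mul_mem Dx_mem_diffOps hP, fun _ _ => rfl⟩
    · exact ⟨Dy * P, mul_mem Dy_mem_diffOps hP, fun _ _ => rfl⟩
  | algebraMap r =>
    exact fun P hP => ⟨algebraMap ℝ _ r * P, mul_mem (algebraMap_mem _ r) hP, fun _ _ => rfl⟩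
  | add Q₁ Q₂ _ _ h₁ h₂ =>
    intro P hP
    obtain ⟨R₁, hR₁, h₁⟩ := h₁ P hP
    obtain ⟨R₂, hR₂, h₂⟩ := h₂ P hP
    exact ⟨R₁ + R₂, add_mem hR₁ hR₂, fun η hη => congrArg₂ (· + ·) (h₁ η hη) (h₂ η hη)⟩
  | mul Q₁ Q₂ _ _ h₁ h₂ =>
    intro P hP
    obtain ⟨R₂, hR₂, h₂⟩ := h₂ P hP
    obtain ⟨R₁, hR₁, h₁⟩ := h₁ R₂ hR₂
    exact ⟨R₁, hR₁, fun η hη => (congrArg Q₁ (h₂ η hη)).trans (h₁ η hη)⟩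

end Kolmogorov

/-- The algebra of linear differential recursion operators of `u_t + x u_y = u_xx` coincides with
the algebra generated by `P⁰, P¹, P², P³`. Operators involving `D_t` as well are, as usual,
identified when they act in the same way on generalized symmetries. -/
theorem mainTheorem8 :
    Kolmogorov.Upsilon = Kolmogorov.UpsilonR ∧
      ∀ Q ∈ Kolmogorov.UpsilonT,
        ∃! R, R ∈ Kolmogorov.UpsilonR ∧ ∀ η ∈ Kolmogorov.genSym, Q η = R η := by
  refine ⟨Kolmogorov.Upsilon_eq_UpsilonR, fun Q hQ => ?_⟩
  obtain ⟨R, hR, hQR⟩ := Kolmogorov.exists_diffOps_eq_on_genSym hQ.1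
  refine ⟨R, ⟨?_, hQR⟩, fun R' hR' => ?_⟩
  · rw [← Kolmogorov.Upsilon_eq_UpsilonR]
    refine ⟨hR, fun η hη => ?_⟩
    rw [← hQR η hη]
    exact hQ.2 η hη
  -- Uniqueness: both operators lie in `diffOps` and agree on the symmetry `u`, which determines
  -- them.
  · have hmem := (Kolmogorov.mem_commutant.1 (Kolmogorov.UpsilonR_le_commutant hR'.1)).1
    refine sub_eq_zero.1 (Kolmogorov.eq_zero_of_apply_u (sub_mem hmem hR) ?_)
    rw [LinearMap.sub_apply, ← hR'.2 _ Kolmogorov.X_u_mem_genSym,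
      ← hQR _ Kolmogorov.X_u_mem_genSym, sub_self]
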